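/- **Setting.** Fix an infinite set of clocks. The *time category* $\mathbb T$ has as objects the pairs $(\mathcal E,\delta)$ of a finite set $\mathcal E$ of clocks and a map $\delta:\mathcal E\to\mathbb N$; a morphism $(\mathcal E,\delta)\to(\mathcal E',\delta')$ is a map $\tau:\mathcal E\to\mathcal E'$ with $\delta'\circ\tau\le\delta$. Fix a choice of coproducts $\mathcal E+\mathcal E'$ of finite sets of clocks (again finite sets of clocks) such that $\mathrm{inl}(\lambda)=\lambda$ for $\lambda\in\mathcal E$. Then $(\mathcal E+\mathcal E',[\delta,\delta'])$ is a coproduct in $\mathbb T$. A context $\Gamma$ is a covariant presheaf on $\mathbb T$ together with a set of clock variables, each clock variable $\kappa$ giving a clock $\gamma(\kappa)\in\mathcal E$ naturally in $\gamma\in\Gamma_{(\mathcal E,\delta)}$. A dependent type $X$ over a covariant presheaf $F$ is a covariant presheaf on the category of elements of $F$: sets $X(x)$ for $x\in F_{(\mathcal E,\delta)}$, with functorial actions $\tau\cdot(-):X(x)\to X(\tau\cdot x)$. A term of $X$ is a family $t(x)\in X(x)$ with $\tau\cdot t(x)=t(\tau\cdot x)$. The context $\Gamma,x{:}X$ consists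 of the pairs $(\gamma,x)$ with $x\in X(\gamma)$. For $Y$ a dependent type over the presheaf of pairs $(x,a)$ with $x\in F$, $a\in X(x)$, the type $\Sigma XY$ has $(\Sigma XY)(x)=\{(a,b)\mid a\in X(x),\ b\in Y(x,a)\}$ with $\tau\cdot(a,b)=(\tau\cdot a,\tau\cdot b)$. For $x\in F_{(\mathcal E,\delta)}$, $(\Pi XY)(x)$ is the set of families $f_\tau:(a\in X(\tau\cdot x))\to Y(\tau\cdot x,a)$, indexed by the morphisms $\tau$ out of $(\mathcal E,\delta)$, with $f_{\rho\tau}(\rho\cdot a)=\rho\cdot f_\tau(a)$; the action is $(\tau\cdot f)_\rho=f_{\rho\tau}$. A dependent type $X$ over $F$ is *invariant under clock introduction* if for all $x\in F_{(\mathcal E,\delta)}$, all $\lambda\notin\mathcal E$ and all $n$ the inclusion $\iota:(\mathcal E,\delta)\to((\mathcal E,\lambda),\delta[\lambda\mapsto n])$ acts by a bijection $X(x)\to X(\iota\cdot x)$. Let $\Delta$ be a finite set of clock variables of $\Gamma$. For $\gamma\in\Gamma_{(\mathcal E,\delta)}$ put $\gamma[\Delta]=\{\gamma(\kappa)\mid\kappa\in\Delta\}$.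 The universe $U_\Delta$ is the dependent type over $\Gamma$ for which $U_\Delta(\gamma)$ is the set of small dependent types over the representable presheaf $y(\gamma[\Delta],\delta|_{\gamma[\Delta]})$ that are invariant under clock introduction, with action $(\tau\cdot X)_\sigma=X_{\sigma\overline\tau}$, where $\overline\tau:\gamma[\Delta]\to\tau\gamma[\Delta]$ is the restriction and corestriction of $\tau$. For a term $A$ of $U_\Delta$ let $\mathrm{El}_\Delta(A)$ be the dependent type $\mathrm{El}_\Delta(A)(\gamma)=A(\gamma)_j$, where $j:(\gamma[\Delta],\delta|_{\gamma[\Delta]})\to(\mathcal E,\delta)$ is the inclusion; $\tau:(\mathcal E,\delta)\to(\mathcal E',\delta')$ acts by $A(\gamma)_j\to A(\gamma)_{\tau j}=A(\tau\cdot\gamma)_{j'}$, where $j'$ is the inclusion of $\tau\gamma[\Delta]$ in $\mathcal E'$. For $\Delta\subseteq\Delta'$ and a term $A$ of $U_\Delta$, the term $\mathrm{in}_{\Delta,\Delta'}(A)$ of $U_{\Delta'}$ is given by $\mathrm{in}_{\Delta,\Delta'}(A)(\gamma)_\sigma=A(\gamma)_{\sigma k}$ for the inclusion $k:\gamma[\Delta]\to\gamma[\Delta']$;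 thus $\mathrm{El}_{\Delta'}(\mathrm{in}_{\Delta,\Delta'}(A))=\mathrm{El}_\Delta(A)$. Let $A$ be a term of $U_\Delta$ in context $\Gamma$ and $B$ a term of $U_\Delta$ in context $\Gamma,x{:}\mathrm{El}_\Delta(A)$. For $\gamma\in\Gamma_{(\mathcal E,\delta)}$ let $(x{:}A).B$ at $\gamma$ be the dependent type over the type $A(\gamma)$ given, for $\sigma:(\gamma[\Delta],\delta|_{\gamma[\Delta]})\to(\mathcal E',\delta')$ and $x\in A(\gamma)_\sigma$, by $$((x{:}A).B)(\gamma)_\sigma(x)=B_{(\mathcal E'+\mathcal E,[\delta',\delta])}\big((\sigma+i)\cdot\gamma,\ \mathrm{inl}\cdot x\big)_h ,$$ where $\sigma+i:\mathcal E\to\mathcal E'+\mathcal E$ maps $\lambda\in\gamma[\Delta]$ to $\mathrm{inl}(\sigma(\lambda))$ and every other $\lambda$ to $\mathrm{inr}(\lambda)$, and $h$ is the inclusion of $(\sigma+i)\gamma[\Delta]=\sigma\gamma[\Delta]$ in $\mathcal E'$. A morphism $\tau$ acts by the action of $\tau$ on the small type $B((\sigma+i)\cdot\gamma,\mathrm{inl}\cdot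 x)$, where $B((\sigma+i)\cdot\gamma,\mathrm{inl}\cdot x)_{\tau h}=((x{:}A).B)(\gamma)_{\tau\sigma}(\tau\cdot x)$ by naturality of $B$ along $\tau+\mathrm{id}$. The codes $\hat\Pi_\Delta x{:}A.B$ and $\hat\Sigma_\Delta x{:}A.B$ are the terms of $U_\Delta$ in context $\Gamma$ whose values at $\gamma$ are the dependent product and the dependent sum of $(x{:}A).B$ at $\gamma$ over $y(\gamma[\Delta],\delta|_{\gamma[\Delta]})$. (These values are invariant under clock introduction and natural in $\gamma$, so that the codes are indeed terms of $U_\Delta$.) **Proposition.** For all $\Gamma$, $\Delta$, $A$, $B$ as above, the following hold as strict equalities, not merely up to isomorphism: $$\mathrm{El}_\Delta(\hat\Pi_\Delta x{:}A.B)=\Pi x{:}\mathrm{El}_\Delta(A).\,\mathrm{El}_\Delta(B),\qquad \mathrm{El}_\Delta(\hat\Sigma_\Delta x{:}A.B)=\Sigma x{:}\mathrm{El}_\Delta(A).\,\mathrm{El}_\Delta(B)$$ as dependent types over $\Gamma$, that is, the sets at every $\gamma$ are equal and the presheaf actions are equal; and for every finite set $\Delta'\supseteq\Delta$ of clock variables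 of $\Gamma$, $$\hat\Pi_{\Delta'}x{:}\mathrm{in}_{\Delta,\Delta'}(A).\,\mathrm{in}_{\Delta,\Delta'}(B)=\mathrm{in}_{\Delta,\Delta'}(\hat\Pi_\Delta x{:}A.B),\qquad \hat\Sigma_{\Delta'}x{:}\mathrm{in}_{\Delta,\Delta'}(A).\,\mathrm{in}_{\Delta,\Delta'}(B)=\mathrm{in}_{\Delta,\Delta'}(\hat\Sigma_\Delta x{:}A.B)$$ as terms of $U_{\Delta'}$, that is, at every $\gamma$. -/

import Mathlib

open CategoryTheory

universe u v w w'

namespace ClockModel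

/-- An object `(E, δ)` of the time category: a finite set `E` of clocks and a function
`δ : E → ℕ`, the number of ticks left on each clock. -/
structure TimeObj (Clk : Type) where
  clocks : Finset Clk
  time : clocks → ℕ

namespace TimeObj

variable {Clk : Type}

/-- A morphism `(E, δ) ⟶ (E', δ')` is a function `τ : E → E'` with `δ' ∘ τ ≤ δ`. -/
@[ext]
structure Hom (P Q : TimeObj Clk) where
  fn : P.clocks → Q.clocks
  le : ∀ l, Q.time (fn l) ≤ P.time l

instance : Category (TimeObj Clk) where
  Hom := Hom
  id P := ⟨fun l => l, fun _ => le_rfl⟩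
  comp f g := ⟨fun l => g.fn (f.fn l), fun l => (g.le _).trans (f.le l)⟩

theorem hom_ext {P Q : TimeObj Clk} {f g : P ⟶ Q} (h : ∀ l, f.fn l = g.fn l) : f = g :=
  Hom.ext (funext h)

@[simp] theorem comp_fn {P Q R : TimeObj Clk} (f : P ⟶ Q) (g : Q ⟶ R) (l : P.clocks) :
    (f ≫ g).fn l = g.fn (f.fn l) := rfl

@[simp] theorem id_fn {P : TimeObj Clk} (l : P.clocks) : Hom.fn (𝟙 P) l = l := rfl

/-- The morphism carried by a set inclusion. -/
def incl (P Q : TimeObj Clk) (h : P.clocks ⊆ Q.clocks)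
    (ht : ∀ l : P.clocks, Q.time ⟨l.1, h l.2⟩ ≤ P.time l) : P ⟶ Q :=
  ⟨fun l => ⟨l.1, h l.2⟩, ht⟩

variable [DecidableEq Clk]

/-- The time object `((E, l), δ[l ↦ n])` for a clock `l ∉ E`. -/
def addClock (P : TimeObj Clk) (l : Clk) (hl : l ∉ P.clocks) (n : ℕ) : TimeObj Clk where
  clocks := Finset.cons l P.clocks hl
  time k := if h : k.1 ∈ P.clocks then P.time ⟨k.1, h⟩ else n

/-- The inclusion `(E, δ) ⟶ ((E, l), δ[l ↦ n])`. -/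
def addIncl (P : TimeObj Clk) (l : Clk) (hl : l ∉ P.clocks) (n : ℕ) : P ⟶ P.addClock l hl n :=
  incl _ _ (Finset.subset_cons hl) (fun k => by simp [addClock])

section Extend

variable {P R : TimeObj Clk} {l : Clk} {hl : l ∉ P.clocks} {n : ℕ}

/-- The morphism out of `((E, l), δ[l ↦ n])` that extends `σ` and maps `l` to `k`. -/
def extend (σ : P ⟶ R) (k : R.clocks) (hk : R.time k ≤ n) : P.addClock l hl n ⟶ R where
  fn m := if h : m.1 ∈ P.clocks then σ.fn ⟨m.1, h⟩ else k
  le m := by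
    by_cases h : m.1 ∈ P.clocks
    · simpa [h, addClock] using Hom.le σ ⟨m.1, h⟩
    · simpa [h, addClock] using hk

theorem addIncl_extend (σ : P ⟶ R) (k : R.clocks) (hk : R.time k ≤ n) :
    P.addIncl l hl n ≫ extend σ k hk = σ :=
  hom_ext fun m => by simp [extend, addIncl, incl]

/-- The clock `l` as an element of `(E, l)`. -/
def newClock (P : TimeObj Clk) (l : Clk) (hl : l ∉ P.clocks) (n : ℕ) :
    (P.addClock l hl n).clocks := ⟨l, Finset.mem_cons_self (h := hl) _ _⟩

theorem extend_newClock (σ : P ⟶ R) (k : R.clocks) (hk : R.time k ≤ n) :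
    (extend σ k hk : P.addClock l hl n ⟶ R).fn (P.newClock l hl n) = k := by
  simp [extend, newClock, hl]

theorem time_newClock : (P.addClock l hl n).time (P.newClock l hl n) = n := by
  simp [addClock, newClock, hl]

theorem addClock_ext {f g : P.addClock l hl n ⟶ R}
    (h : P.addIncl l hl n ≫ f = P.addIncl l hl n ≫ g)
    (h' : f.fn (P.newClock l hl n) = g.fn (P.newClock l hl n)) : f = g := by
  refine hom_ext ?_
  rintro ⟨m, hm⟩
  rcases (Finset.mem_cons (h := hl)).1 hm with hm' | hm'
  · have : (⟨m, hm⟩ : (P.addClock l hl n).clocks) = P.newClock l hl n := Subtype.ext hm'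
    rw [this, h']
  · exact congrArg (fun k : P ⟶ R => k.fn ⟨m, hm'⟩) h

end Extend

/-- The time object `(g[D], δ|g[D])` for `g : D → E`. -/
def im {D : Type} [Fintype D] (P : TimeObj Clk) (g : D → P.clocks) : TimeObj Clk where
  clocks := Finset.univ.image fun d => (g d : Clk)
  time l := P.time ⟨l.1, by
    obtain ⟨d, -, hd⟩ := Finset.mem_image.1 l.2
    exact hd ▸ (g d).2⟩

theorem mem_im {D : Type} [Fintype D] {P : TimeObj Clk} {g : D → P.clocks} {l : Clk} :
    l ∈ (P.im g).clocks ↔ ∃ d, (g d : Clk) = l := by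
  simp [im]

theorem im_subset {D : Type} [Fintype D] (P : TimeObj Clk) (g : D → P.clocks) :
    (P.im g).clocks ⊆ P.clocks := fun l hl => by
  obtain ⟨d, hd⟩ := mem_im.1 hl
  exact hd ▸ (g d).2

/-- The inclusion `(g[D], δ|g[D]) ⟶ (E, δ)`. -/
def imIncl {D : Type} [Fintype D] (P : TimeObj Clk) (g : D → P.clocks) : P.im g ⟶ P :=
  incl _ _ (P.im_subset g) (fun _ => le_rfl)

/-- The restriction and corestriction `(g[D], δ|g[D]) ⟶ (σ[g[D]], δ'|σ[g[D]])` of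
`σ : (E, δ) ⟶ (E', δ')`. -/
def cores {D : Type} [Fintype D] {P Q : TimeObj Clk} (σ : P ⟶ Q) {g : D → P.clocks}
    {g' : D → Q.clocks} (h : (fun d => σ.fn (g d)) = g') : P.im g ⟶ Q.im g' where
  fn l := ⟨(σ.fn ((P.imIncl g).fn l)).1, by
    obtain ⟨d, hd⟩ := mem_im.1 l.2
    refine mem_im.2 ⟨d, ?_⟩
    subst h
    have : (P.imIncl g).fn l = g d := Subtype.ext hd.symm
    rw [this]⟩
  le l := Hom.le σ _

theorem cores_imIncl {D : Type} [Fintype D] {P Q : TimeObj Clk} (σ : P ⟶ Q) {g : D → P.clocks}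
    {g' : D → Q.clocks} (h : (fun d => σ.fn (g d)) = g') :
    cores σ h ≫ Q.imIncl g' = P.imIncl g ≫ σ := rfl

end TimeObj

variable {Clk : Type}

/-- The covariant presheaf `y(E, δ)` of morphisms out of `(E, δ)`. -/
abbrev yo (P : TimeObj Clk) : TimeObj Clk ⥤ Type := coyoneda.obj (Opposite.op P)

/-- Natural maps between covariant presheaves, possibly in different universes. -/
structure PMap (F : TimeObj Clk ⥤ Type w) (G : TimeObj Clk ⥤ Type w') where
  app : ∀ {P : TimeObj Clk}, F.obj P → G.obj P
  nat : ∀ {P Q : TimeObj Clk} (f : P ⟶ Q) (x : F.obj P), G.map f (app x) = app (F.map f x)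

/-- A dependent type over the covariant presheaf `F`: a set `A(x)` for every `x ∈ F(E, δ)`, and for
every `f : (E, δ) ⟶ (E', δ')` an action `f · (-) : A(x) → A(f · x)`, functorially. This is a presheaf
on the category of elements of `F`. The target of the action is an arbitrary `y` with `f · x = y`. -/
structure PTy (F : TimeObj Clk ⥤ Type w) where
  fam : ∀ {P : TimeObj Clk}, F.obj P → Type v
  act : ∀ {P Q : TimeObj Clk} (f : P ⟶ Q) {x : F.obj P} {y : F.obj Q},
    F.map f x = y → fam x → fam y
  act_id : ∀ {P : TimeObj Clk} {x : F.obj P} (h : F.map (𝟙 P) x = x) (a : fam x),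
    act (𝟙 P) h a = a
  act_comp : ∀ {P Q R : TimeObj Clk} (f : P ⟶ Q) (g : Q ⟶ R) {x : F.obj P} {y : F.obj Q}
    {z : F.obj R} (h : F.map f x = y) (h' : F.map g y = z) (h'' : F.map (f ≫ g) x = z)
    (a : fam x), act (f ≫ g) h'' a = act g h' (act f h a)

/-- A term of a dependent type: an element `t(x) ∈ A(x)` for every `x`, with
`f · t(x) = t(f · x)`. -/
structure Tm (F : TimeObj Clk ⥤ Type w) (A : PTy.{v} F) where
  app : ∀ {P : TimeObj Clk} (x : F.obj P), A.fam x
  nat : ∀ {P Q : TimeObj Clk} (f : P ⟶ Q) {x : F.obj P} {y : F.obj Q} (h : F.map f x = y),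
    A.act f h (app x) = app y

namespace PTy

variable {F : TimeObj Clk ⥤ Type w} {G : TimeObj Clk ⥤ Type w'}

/-- Substitution of a type along a map of presheaves. -/
def subst (s : PMap F G) (A : PTy.{v} G) : PTy.{v} F where
  fam x := A.fam (s.app x)
  act f _ _ h := A.act f (by rw [s.nat, h])
  act_id _ a := A.act_id _ a
  act_comp f g _ _ _ _ _ _ a := A.act_comp f g _ _ _ a

/-- Context extension: the presheaf of pairs `(x, a)` with `a ∈ A(x)`. -/
abbrev total (A : PTy.{v} F) : TimeObj Clk ⥤ Type (max w v) where
  obj P := Σ x : F.obj P, A.fam x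
  map f := TypeCat.ofHom fun p => ⟨F.map f p.1, A.act f rfl p.2⟩
  map_id P := by
    apply ConcreteCategory.hom_ext
    rintro ⟨x, a⟩
    have key : ∀ y (h : F.map (𝟙 P) x = y) (_ : y = x),
        (⟨y, A.act (𝟙 P) h a⟩ : Σ x : F.obj P, A.fam x) = ⟨x, a⟩ := by
      rintro y h rfl
      rw [A.act_id]
    exact key _ rfl (by simp)
  map_comp {P Q R} f g := by
    apply ConcreteCategory.hom_ext
    rintro ⟨x, a⟩
    have key : ∀ z (h : F.map (f ≫ g) x = z) (h' : F.map g (F.map f x) = z),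
        (⟨z, A.act (f ≫ g) h a⟩ : Σ x : F.obj R, A.fam x) =
          ⟨F.map g (F.map f x), A.act g rfl (A.act f rfl a)⟩ := by
      rintro z h rfl
      rw [A.act_comp f g rfl rfl]
    exact key _ rfl (by simp)

theorem total_map (A : PTy.{v} F) {P Q : TimeObj Clk} (f : P ⟶ Q) {x : F.obj P} {y : F.obj Q}
    (h : F.map f x = y) (a : A.fam x) :
    A.total.map f ⟨x, a⟩ = ⟨y, A.act f h a⟩ := by
  subst h; rfl

/-- Transport of elements along an equality of base points. -/
def tr (A : PTy.{v} F) {P : TimeObj Clk} {x y : F.obj P} (e : x = y) (a : A.fam x) : A.fam y :=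
  e ▸ a

theorem total_tr (A : PTy.{v} F) {P : TimeObj Clk} {x y : F.obj P} (e : x = y) (a : A.fam x) :
    (⟨y, A.tr e a⟩ : A.total.obj P) = ⟨x, a⟩ := by
  subst e; rfl

theorem tr_tr (A : PTy.{v} F) {P : TimeObj Clk} {x y z : F.obj P} (e : x = y) (e' : y = z)
    (a : A.fam x) : A.tr e' (A.tr e a) = A.tr (e.trans e') a := by
  subst e; rfl

theorem act_heq (A : PTy.{v} F) {P Q : TimeObj Clk} {f g : P ⟶ Q} (hf : f = g)
    {x x' : F.obj P} {y y' : F.obj Q}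
    (h : F.map f x = y) (h' : F.map g x' = y') (hx : x = x') {a : A.fam x} {a' : A.fam x'}
    (ha : HEq a a') : HEq (A.act f h a) (A.act g h' a') := by
  subst hf hx h h' ha; rfl

theorem act_act_heq (A : PTy.{v} F) {P Q R : TimeObj Clk} {f : P ⟶ Q} {g : Q ⟶ R} {k : P ⟶ R}
    (hk : f ≫ g = k) {x : F.obj P} {y : F.obj Q} {z z' : F.obj R} (h : F.map f x = y)
    (h' : F.map g y = z) (h'' : F.map k x = z') (a : A.fam x) :
    HEq (A.act g h' (A.act f h a)) (A.act k h'' a) := by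
  subst hk h h''
  have e : F.map (f ≫ g) x = z := by simpa using h'
  subst e
  exact heq_of_eq (A.act_comp _ _ _ _ _ _).symm

theorem ext_heq {A B : PTy.{v} F}
    (h : ∀ (P : TimeObj Clk) (x : F.obj P), A.fam x = B.fam x)
    (h' : ∀ (P Q : TimeObj Clk) (f : P ⟶ Q) (x : F.obj P) (y : F.obj Q) (k : F.map f x = y)
      (a : A.fam x) (b : B.fam x), HEq a b → HEq (A.act f k a) (B.act f k b)) : A = B := by
  obtain ⟨famA, actA, _, _⟩ := A
  obtain ⟨famB, actB, _, _⟩ := B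
  have e : @famA = @famB := by
    funext P x; exact h P x
  subst e
  have e' : @actA = @actB := by
    funext P Q f x y k a
    exact eq_of_heq (h' P Q f x y k a a HEq.rfl)
  subst e'
  rfl

theorem tr_heq (A : PTy.{v} F) {P : TimeObj Clk} {x y : F.obj P} (e : x = y) (a : A.fam x) :
    HEq (A.tr e a) a := by
  subst e; rfl

theorem total_ext (A : PTy.{v} F) {P : TimeObj Clk} {x y : F.obj P} (e : x = y)
    {a : A.fam x} {b : A.fam y} (h : HEq a b) : (⟨x, a⟩ : A.total.obj P) = ⟨y, b⟩ := by
  subst e h; rfl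

/-- Dependent sums: pairs `(a, b)` with `a ∈ A(x)` and `b ∈ B(x, a)`, and
`f · (a, b) = (f · a, f · b)`. -/
def sigma (A : PTy.{v} F) (B : PTy.{v} A.total) : PTy.{v} F where
  fam {P} x := Σ a : A.fam x, B.fam (P := P) ⟨x, a⟩
  act f _ _ h p := ⟨A.act f h p.1, B.act f (A.total_map f h p.1) p.2⟩
  act_id {P x} h p := by
    refine Sigma.ext (A.act_id h _) ?_
    refine HEq.trans (B.act_heq rfl _ (by rw [total_map _ _ h, A.act_id]) rfl HEq.rfl)
      (heq_of_eq (B.act_id _ _))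
  act_comp {P Q R} f g {x y z} h h' h'' p := by
    refine Sigma.ext (A.act_comp f g h h' h'' _) ?_
    refine HEq.trans (B.act_heq rfl _ ?_ rfl HEq.rfl) (heq_of_eq (B.act_comp f g _ _ ?_ _))
    all_goals rw [total_map _ _ h'', A.act_comp f g h h']

/-- Naturality `τ · f_σ(a) = f_{τ ∘ σ}(τ · a)` of a family `f`. -/
def IsNatural (A : PTy.{v} F) (B : PTy.{v} A.total) {P : TimeObj Clk} {x : F.obj P}
    (f : ∀ (Q : TimeObj Clk) (σ : P ⟶ Q) (a : A.fam (F.map σ x)),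
      B.fam (P := Q) ⟨F.map σ x, a⟩) : Prop :=
  ∀ (Q R : TimeObj Clk) (σ : P ⟶ Q) (τ : Q ⟶ R) (a : A.fam (F.map σ x)),
    B.act τ (A.total_map τ (by simp) a) (f Q σ a) =
      f R (σ ≫ τ) (A.act τ (by simp) a)

/-- The action `(τ · f)_ρ = f_{ρ ∘ τ}` on families. -/
def precomp (A : PTy.{v} F) (B : PTy.{v} A.total) {P Q : TimeObj Clk} (τ : P ⟶ Q)
    {x : F.obj P} {y : F.obj Q} (h : F.map τ x = y)
    (f : ∀ (R : TimeObj Clk) (σ : P ⟶ R) (a : A.fam (F.map σ x)),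
      B.fam (P := R) ⟨F.map σ x, a⟩) (R : TimeObj Clk) (ρ : Q ⟶ R)
    (a : A.fam (F.map ρ y)) : B.fam (P := R) ⟨F.map ρ y, a⟩ :=
  B.tr (A.total_tr (show F.map ρ y = F.map (τ ≫ ρ) x by simp [← h]) a)
    (f R (τ ≫ ρ) (A.tr (by simp [← h]) a))

theorem family_heq {A : PTy.{v} F} {B : PTy.{v} A.total} {P : TimeObj Clk} {x : F.obj P}
    (f : ∀ (Q : TimeObj Clk) (σ : P ⟶ Q) (a : A.fam (F.map σ x)),
      B.fam (P := Q) ⟨F.map σ x, a⟩) {Q : TimeObj Clk} {σ σ' : P ⟶ Q}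
    {a : A.fam (F.map σ x)} {a' : A.fam (F.map σ' x)} (hσ : σ = σ') (ha : HEq a a') :
    HEq (f Q σ a) (f Q σ' a') := by
  subst hσ ha
  rfl

theorem precomp_heq (A : PTy.{v} F) (B : PTy.{v} A.total) {P Q : TimeObj Clk} (τ : P ⟶ Q)
    {x : F.obj P} {y : F.obj Q} (h : F.map τ x = y)
    (f : ∀ (R : TimeObj Clk) (σ : P ⟶ R) (a : A.fam (F.map σ x)),
      B.fam (P := R) ⟨F.map σ x, a⟩) {R : TimeObj Clk} {ρ : Q ⟶ R} {σ : P ⟶ R} (hσ : τ ≫ ρ = σ)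
    {a : A.fam (F.map ρ y)} {a' : A.fam (F.map σ x)} (ha : HEq a a') :
    HEq (precomp A B τ h f R ρ a) (f R σ a') :=
  (B.tr_heq _ _).trans (family_heq f hσ ((A.tr_heq _ _).trans ha))

theorem precomp_natural {A : PTy.{v} F} {B : PTy.{v} A.total} {P Q : TimeObj Clk} (τ : P ⟶ Q)
    {x : F.obj P} {y : F.obj Q} (h : F.map τ x = y)
    {f : ∀ (R : TimeObj Clk) (σ : P ⟶ R) (a : A.fam (F.map σ x)),
      B.fam (P := R) ⟨F.map σ x, a⟩} (hf : IsNatural A B f) :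
    IsNatural A B (precomp A B τ h f) := by
  intro R S ρ ω a
  have e : F.map ρ y = F.map (τ ≫ ρ) x := by simp [← h]
  have key := hf R S (τ ≫ ρ) ω (A.tr e a)
  apply eq_of_heq
  refine HEq.trans ?_ ((heq_of_eq key).trans ?_)
  · refine B.act_heq rfl _ _ (A.total_tr e a).symm (B.tr_heq _ _)
  · refine (precomp_heq A B τ h f (by simp) ?_).symm
    exact A.act_heq rfl _ _ e (A.tr_heq _ _).symm

/-- Dependent products: families `f_σ(a) ∈ B(σ · x, a)`, indexed by the morphisms `σ` out of `P`
and by `a ∈ A(σ · x)`, that satisfy `f_{τ ∘ σ}(τ · a) = τ · f_σ(a)`. The action is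
`(τ · f)_ρ = f_{ρ ∘ τ}`. -/
def pi (A : PTy.{v} F) (B : PTy.{v} A.total) : PTy.{v} F where
  fam {P} x := {f : ∀ (Q : TimeObj Clk) (σ : P ⟶ Q) (a : A.fam (F.map σ x)),
    B.fam (P := Q) ⟨F.map σ x, a⟩ // IsNatural A B f}
  act τ _ _ h f := ⟨precomp A B τ h f.1, precomp_natural τ h f.2⟩
  act_id h f := by
    apply Subtype.ext
    funext Q σ a
    exact eq_of_heq (precomp_heq A B (𝟙 _) h f.1 (ρ := σ) (Category.id_comp σ) (a := a) HEq.rfl)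
  act_comp τ ρ x y z h h' h'' f := by
    apply Subtype.ext
    funext Q σ a
    have e : F.map σ z = F.map (ρ ≫ σ) y := by simp [← h']
    have e' : F.map (ρ ≫ σ) y = F.map ((τ ≫ ρ) ≫ σ) x := by simp [← h]
    refine eq_of_heq ((precomp_heq A B _ h'' f.1 rfl (a' := A.tr e' (A.tr e a))
      (by rw [tr_tr]; exact (A.tr_heq _ _).symm)).trans ?_)
    refine ((precomp_heq A B ρ h' _ rfl (a' := A.tr e a) (A.tr_heq _ _).symm).trans ?_).symm
    exact precomp_heq A B τ h f.1 (by simp) (A.tr_heq _ _).symm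

section Congr

/-- Natural families for explicitly given fibres and actions on the slice under `P`. -/
abbrev PiRaw {P : TimeObj Clk} (X : ∀ (Q : TimeObj Clk), (P ⟶ Q) → Type v)
    (actX : ∀ {Q R : TimeObj Clk} (σ : P ⟶ Q) (τ : Q ⟶ R), X Q σ → X R (σ ≫ τ))
    (Y : ∀ (Q : TimeObj Clk) (σ : P ⟶ Q), X Q σ → Type v)
    (actY : ∀ {Q R : TimeObj Clk} (σ : P ⟶ Q) (τ : Q ⟶ R) (a : X Q σ), Y Q σ a →
      Y R (σ ≫ τ) (actX σ τ a)) : Type _ :=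
  {f : ∀ (Q : TimeObj Clk) (σ : P ⟶ Q) (a : X Q σ), Y Q σ a //
    ∀ (Q R : TimeObj Clk) (σ : P ⟶ Q) (τ : Q ⟶ R) (a : X Q σ),
      actY σ τ a (f Q σ a) = f R (σ ≫ τ) (actX σ τ a)}

theorem pi_congr {X : PTy.{v} F} {Y : PTy.{v} X.total} {X' : PTy.{v} G} {Y' : PTy.{v} X'.total}
    {P : TimeObj Clk} {x : F.obj P} {x' : G.obj P}
    (h₁ : ∀ (Q : TimeObj Clk) (σ : P ⟶ Q), X.fam (F.map σ x) = X'.fam (G.map σ x'))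
    (h₂ : ∀ (Q R : TimeObj Clk) (σ : P ⟶ Q) (τ : Q ⟶ R) (a : X.fam (F.map σ x))
      (a' : X'.fam (G.map σ x')), HEq a a' →
      HEq (X.act τ (show _ = F.map (σ ≫ τ) x by simp) a)
        (X'.act τ (show _ = G.map (σ ≫ τ) x' by simp) a'))
    (h₃ : ∀ (Q : TimeObj Clk) (σ : P ⟶ Q) (a : X.fam (F.map σ x)) (a' : X'.fam (G.map σ x')),
      HEq a a' → Y.fam (P := Q) ⟨F.map σ x, a⟩ = Y'.fam (P := Q) ⟨G.map σ x', a'⟩)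
    (h₄ : ∀ (Q R : TimeObj Clk) (σ : P ⟶ Q) (τ : Q ⟶ R) (a : X.fam (F.map σ x))
      (a' : X'.fam (G.map σ x')), HEq a a' → ∀ (b : Y.fam (P := Q) ⟨F.map σ x, a⟩)
      (b' : Y'.fam (P := Q) ⟨G.map σ x', a'⟩), HEq b b' →
      HEq (Y.act τ (X.total_map τ (show _ = F.map (σ ≫ τ) x by simp) a) b)
        (Y'.act τ (X'.total_map τ (show _ = G.map (σ ≫ τ) x' by simp) a') b')) :
    (X.pi Y).fam x = (X'.pi Y').fam x' ∧
    ∀ (f : (X.pi Y).fam x) (f' : (X'.pi Y').fam x'), HEq f f' ↔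
      ∀ (Q : TimeObj Clk) (σ : P ⟶ Q) (a : X.fam (F.map σ x)) (a' : X'.fam (G.map σ x')),
        HEq a a' → HEq (f.1 Q σ a) (f'.1 Q σ a') := by
  have key : ∀ (X₁ X₂ : ∀ (Q : TimeObj Clk), (P ⟶ Q) → Type v) (_ : X₁ = X₂)
      (aX₁ : ∀ (Q R : TimeObj Clk) (σ : P ⟶ Q) (τ : Q ⟶ R), X₁ Q σ → X₁ R (σ ≫ τ))
      (aX₂ : ∀ (Q R : TimeObj Clk) (σ : P ⟶ Q) (τ : Q ⟶ R), X₂ Q σ → X₂ R (σ ≫ τ))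
      (_ : ∀ Q R σ τ a a', HEq a a' → HEq (aX₁ Q R σ τ a) (aX₂ Q R σ τ a'))
      (Y₁ : ∀ (Q : TimeObj Clk) (σ : P ⟶ Q), X₁ Q σ → Type v)
      (Y₂ : ∀ (Q : TimeObj Clk) (σ : P ⟶ Q), X₂ Q σ → Type v)
      (_ : ∀ Q σ a a', HEq a a' → Y₁ Q σ a = Y₂ Q σ a')
      (aY₁ : ∀ (Q R : TimeObj Clk) (σ : P ⟶ Q) (τ : Q ⟶ R) (a : X₁ Q σ), Y₁ Q σ a →
        Y₁ R (σ ≫ τ) (aX₁ Q R σ τ a))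
      (aY₂ : ∀ (Q R : TimeObj Clk) (σ : P ⟶ Q) (τ : Q ⟶ R) (a : X₂ Q σ), Y₂ Q σ a →
        Y₂ R (σ ≫ τ) (aX₂ Q R σ τ a))
      (_ : ∀ Q R σ τ a a', HEq a a' → ∀ b b', HEq b b' →
        HEq (aY₁ Q R σ τ a b) (aY₂ Q R σ τ a' b')),
      PiRaw X₁ (aX₁ _ _) Y₁ (aY₁ _ _) = PiRaw X₂ (aX₂ _ _) Y₂ (aY₂ _ _) ∧
      ∀ (f : PiRaw X₁ (aX₁ _ _) Y₁ (aY₁ _ _)) (f' : PiRaw X₂ (aX₂ _ _) Y₂ (aY₂ _ _)),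
        HEq f f' ↔ ∀ Q σ a a', HEq a a' → HEq (f.1 Q σ a) (f'.1 Q σ a') := by
    rintro X₁ _ rfl aX₁ aX₂ hX Y₁ Y₂ hY aY₁ aY₂ hA
    obtain rfl : aX₁ = aX₂ := by
      funext Q R σ τ a; exact eq_of_heq (hX Q R σ τ a a HEq.rfl)
    obtain rfl : Y₁ = Y₂ := by
      funext Q σ a; exact hY Q σ a a HEq.rfl
    obtain rfl : aY₁ = aY₂ := by
      funext Q R σ τ a b; exact eq_of_heq (hA Q R σ τ a a HEq.rfl b b HEq.rfl)
    refine ⟨rfl, fun f f' => ⟨?_, fun h => heq_of_eq (Subtype.ext ?_)⟩⟩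
    · intro h Q σ a a' ha
      cases h; cases ha; rfl
    · funext Q σ a
      exact eq_of_heq (h Q σ a a HEq.rfl)
  exact key _ _ (by funext Q σ; exact h₁ Q σ) _ _ h₂ _ _ h₃ _ _ h₄

variable {X : PTy.{v} F} {Y : PTy.{v} X.total} {X' : PTy.{v} G} {Y' : PTy.{v} X'.total}
  {s : PMap F G}

theorem pi_subst (e : X = X'.subst s)
    (h₃ : ∀ (Q : TimeObj Clk) (x : F.obj Q) (a : X.fam x) (a' : X'.fam (s.app x)),
      HEq a a' → Y.fam (P := Q) ⟨x, a⟩ = Y'.fam (P := Q) ⟨s.app x, a'⟩)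
    (h₄ : ∀ (Q R : TimeObj Clk) (τ : Q ⟶ R) (x : F.obj Q) (y : F.obj R) (h : F.map τ x = y)
      (a : X.fam x) (a' : X'.fam (s.app x)), HEq a a' → ∀ (b : Y.fam (P := Q) ⟨x, a⟩)
      (b' : Y'.fam (P := Q) ⟨s.app x, a'⟩), HEq b b' →
      HEq (Y.act τ (X.total_map τ h a) b)
        (Y'.act τ (X'.total_map τ ((s.nat τ x).trans (congrArg _ h)) a') b')) :
    X.pi Y = (X'.pi Y').subst s := by
  subst e
  have aux : ∀ {Q : TimeObj Clk} {z : F.obj Q} {w : G.obj Q} (e : s.app z = w)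
      (a : X'.fam (s.app z)) (a' : X'.fam w), HEq a a' →
      (⟨s.app z, a⟩ : X'.total.obj Q) = ⟨w, a'⟩ := fun e a a' h => X'.total_ext e h
  have sn : ∀ {P Q : TimeObj Clk} (σ : P ⟶ Q) (x : F.obj P), s.app (F.map σ x) = G.map σ (s.app x) :=
    fun σ x => (s.nat σ x).symm
  have main := fun (P : TimeObj Clk) (x : F.obj P) =>
    pi_congr (X := X'.subst s) (Y := Y) (X' := X') (Y' := Y') (x := x) (x' := s.app x)
      (fun Q σ => congrArg X'.fam (sn σ x))
      (fun Q R σ τ a a' h => X'.act_heq rfl _ _ (sn σ x) h)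
      (fun Q σ a a' h => (h₃ Q _ a a HEq.rfl).trans (congrArg Y'.fam (aux (sn σ x) a a' h)))
      (fun Q R σ τ a a' h b b' hb => by
        have hy := h₃ Q _ a a HEq.rfl
        have hb' : HEq b (cast hy b) := (cast_heq _ _).symm
        exact (h₄ Q R τ _ _ _ a a HEq.rfl b _ hb').trans
          (Y'.act_heq rfl _ _ (aux (sn σ x) a a' h) (hb'.symm.trans hb)))
  refine ext_heq (fun P x => (main P x).1) ?_
  intro P Q f x y k a b hab
  refine ((main Q y).2 _ _).2 fun R σ c c' hc => ?_
  subst k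
  refine (precomp_heq (X'.subst s) Y f rfl a.1 rfl (a' := (X'.subst s).tr (by simp) c)
    ((X'.subst s).tr_heq _ _).symm).trans ?_
  refine HEq.trans ?_ (precomp_heq X' Y' f (s.nat f x) b.1 rfl (a' := X'.tr (by
    rw [← s.nat, G.map_comp]; rfl) c') (X'.tr_heq _ _).symm).symm
  exact ((main P x).2 a b).1 hab _ _ _ _
    (((X'.subst s).tr_heq _ _).trans (hc.trans (X'.tr_heq _ _).symm))

theorem sigma_subst (e : X = X'.subst s)
    (h₃ : ∀ (Q : TimeObj Clk) (x : F.obj Q) (a : X.fam x) (a' : X'.fam (s.app x)),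
      HEq a a' → Y.fam (P := Q) ⟨x, a⟩ = Y'.fam (P := Q) ⟨s.app x, a'⟩)
    (h₄ : ∀ (Q R : TimeObj Clk) (τ : Q ⟶ R) (x : F.obj Q) (y : F.obj R) (h : F.map τ x = y)
      (a : X.fam x) (a' : X'.fam (s.app x)), HEq a a' → ∀ (b : Y.fam (P := Q) ⟨x, a⟩)
      (b' : Y'.fam (P := Q) ⟨s.app x, a'⟩), HEq b b' →
      HEq (Y.act τ (X.total_map τ h a) b)
        (Y'.act τ (X'.total_map τ ((s.nat τ x).trans (congrArg _ h)) a') b')) :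
    X.sigma Y = (X'.sigma Y').subst s := by
  subst e
  have sig : ∀ {T : Type v} {Z Z' : T → Type v} (_ : ∀ a, Z a = Z' a),
      (Σ a, Z a) = (Σ a, Z' a) := fun h => congrArg _ (funext h)
  have sig' : ∀ {T : Type v} {Z Z' : T → Type v} (_ : ∀ a, Z a = Z' a) (p : Σ a, Z a)
      (q : Σ a, Z' a), HEq p q ↔ p.1 = q.1 ∧ HEq p.2 q.2 := by
    intro T Z Z' h p q
    obtain rfl : Z = Z' := funext h
    rw [heq_iff_eq, Sigma.ext_iff]
  refine ext_heq (fun P x => sig fun a => h₃ P x a a HEq.rfl) ?_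
  intro P Q f x y k p q hpq
  have hpq' := (sig' (fun a => h₃ P x a a HEq.rfl) p q).1 hpq
  refine (sig' (fun a => h₃ Q y a a HEq.rfl) _ _).2 ⟨?_, ?_⟩
  · exact congrArg (X'.act f _) hpq'.1
  · exact h₄ P Q f x y k p.1 q.1 (heq_of_eq hpq'.1) p.2 q.2 hpq'.2

end Congr

variable [DecidableEq Clk]

/-- Invariance under clock introduction: for a clock `l ∉ E`, the action
`A(x) → A(ι · x)` of the inclusion `ι : (E, δ) ⟶ ((E, l), δ[l ↦ n])` is a bijection. -/
def Invariant (A : PTy.{v} F) : Prop :=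
  ∀ (P : TimeObj Clk) (l : Clk) (hl : l ∉ P.clocks) (n : ℕ) (x : F.obj P),
    Function.Bijective (A.act (P.addIncl l hl n) rfl : A.fam x → A.fam (F.map _ x))

theorem Invariant.act {A : PTy.{v} F} (hA : A.Invariant) {P : TimeObj Clk} {l : Clk}
    {hl : l ∉ P.clocks} {n : ℕ} {x : F.obj P} {y : F.obj (P.addClock l hl n)}
    (h : F.map (P.addIncl l hl n) x = y) :
    Function.Bijective (A.act (P.addIncl l hl n) h) := by
  subst h
  exact hA P l hl n x

theorem Invariant.subst {A : PTy.{v} G} (hA : A.Invariant) (s : PMap F G) :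
    (A.subst s).Invariant :=
  fun _ _ _ _ x => hA.act (s.nat _ x)

theorem Invariant.sigma {A : PTy.{v} F} {B : PTy.{v} A.total} (hA : A.Invariant)
    (hB : B.Invariant) : (A.sigma B).Invariant := by
  intro P l hl n x
  have e : (A.sigma B).act (P.addIncl l hl n) (rfl : F.map _ x = _) =
    Sigma.map (A.act (P.addIncl l hl n) (rfl : F.map _ x = _))
      (fun a => B.act (P.addIncl l hl n) (A.total_map _ rfl a)) := rfl
  rw [e]
  exact ⟨(hA P l hl n x).1.sigma_map fun a => (hB.act _).1,
    (hA P l hl n x).2.sigma_map fun a => (hB.act _).2⟩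

theorem Invariant.pi [Infinite Clk] {A : PTy.{v} F} {B : PTy.{v} A.total}
    (hB : B.Invariant) : (A.pi B).Invariant := by
  intro P l hl n x
  let ι := P.addIncl l hl n
  have fresh : ∀ Q : TimeObj Clk, ∃ m, m ∉ Q.clocks := fun Q => Infinite.exists_notMem_finset _
  choose m hm using fresh
  let up (Q : TimeObj Clk) := Q.addClock (m Q) (hm Q) n
  let j (Q : TimeObj Clk) : Q ⟶ up Q := Q.addIncl (m Q) (hm Q) n
  let k (Q : TimeObj Clk) : (up Q).clocks := Q.newClock (m Q) (hm Q) n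
  have hk : ∀ Q, (up Q).time (k Q) ≤ n := fun Q => TimeObj.time_newClock.le
  let lift {Q : TimeObj Clk} (σ : P ⟶ Q) : P.addClock l hl n ⟶ up Q :=
    TimeObj.extend (σ ≫ j Q) (k Q) (hk Q)
  have hlift : ∀ {Q : TimeObj Clk} (σ : P ⟶ Q), ι ≫ lift σ = σ ≫ j Q :=
    fun σ => TimeObj.addIncl_extend _ _ _
  have hlift' : ∀ {Q : TimeObj Clk} (σ : P ⟶ Q), (lift σ).fn (P.newClock l hl n) = k Q :=
    fun σ => TimeObj.extend_newClock _ _ _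
  have inj : ∀ {Q : TimeObj Clk} {z : F.obj Q} {a : A.fam z} {b b' : B.fam (P := Q) ⟨z, a⟩},
      B.act (j Q) rfl b = B.act (j Q) rfl b' → b = b' := fun h => (hB.act _).1 h
  constructor
  · intro f f' hff
    apply Subtype.ext
    funext Q σ a
    apply inj
    have e : F.map (lift σ) (F.map ι x) = F.map (j Q) (F.map σ x) := by
      rw [← F.map_comp_apply, ← F.map_comp_apply, hlift]
    have step : ∀ f : (A.pi B).fam x, HEq (B.act (j Q) rfl (f.1 Q σ a))
        (((A.pi B).act ι rfl f).1 _ (lift σ) (A.tr e.symm (A.act (j Q) rfl a))) := by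
      intro f
      refine HEq.trans (B.act_heq rfl _ (A.total_map _ (by simp) _) rfl HEq.rfl)
        ((heq_of_eq (f.2 _ _ σ (j Q) a)).trans ?_)
      refine (precomp_heq A B ι rfl f.1 (hlift σ) ((A.tr_heq _ _).trans ?_)).symm
      exact A.act_heq rfl _ _ rfl HEq.rfl
    exact eq_of_heq ((step f).trans ((heq_of_eq (by rw [hff])).trans (step f').symm))
  · intro g
    have e : ∀ {Q : TimeObj Clk} (σ : P ⟶ Q),
        F.map (lift σ) (F.map ι x) = F.map (j Q) (F.map σ x) := fun σ => by
      rw [← F.map_comp_apply, ← F.map_comp_apply, hlift]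
    have ex : ∀ (Q : TimeObj Clk) (σ : P ⟶ Q) (a : A.fam (F.map σ x)),
        ∃ b : B.fam (P := Q) ⟨F.map σ x, a⟩, HEq (B.act (j Q) rfl b)
          (g.1 _ (lift σ) (A.tr (e σ).symm (A.act (j Q) rfl a))) := by
      intro Q σ a
      have e' : A.total.map (j Q) ⟨F.map σ x, a⟩ =
        ⟨F.map (j Q) (F.map σ x), A.act (j Q) rfl a⟩ := rfl
      obtain ⟨b, hb⟩ := (hB.act e').2 (B.tr (A.total_tr (e σ).symm (A.act (j Q) rfl a))
          (g.1 _ (lift σ) (A.tr (e σ).symm (A.act (j Q) rfl a))))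
      exact ⟨b, (heq_of_eq hb).trans (B.tr_heq _ _)⟩
    choose f hf using ex
    have hnat : IsNatural A B f := by
      intro Q R σ τ a
      apply inj
      let τ' : up Q ⟶ up R := TimeObj.extend (τ ≫ j R) (k R) (hk R)
      have hτ : j Q ≫ τ' = τ ≫ j R := TimeObj.addIncl_extend _ _ _
      have hτ' : lift σ ≫ τ' = lift (σ ≫ τ) := by
        apply TimeObj.addClock_ext
        · change ι ≫ _ = ι ≫ _
          rw [hlift, ← Category.assoc, hlift, Category.assoc, hτ, Category.assoc]
        · rw [hlift', TimeObj.comp_fn, hlift']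
          exact TimeObj.extend_newClock _ _ _
      have key := g.2 _ _ (lift σ) τ' (A.tr (e σ).symm (A.act (j Q) rfl a))
      apply eq_of_heq
      refine (B.act_act_heq rfl _ _ rfl _).trans ?_
      refine HEq.trans ?_ (hf _ (σ ≫ τ) _).symm
      refine (B.act_act_heq hτ rfl rfl rfl _).symm.trans ?_
      refine (B.act_heq rfl rfl (A.total_map (y := F.map (lift σ ≫ τ') (F.map ι x)) _ (by simp [ι]) _)
        (A.total_tr _ _).symm (hf _ _ _)).trans ?_
      refine (heq_of_eq key).trans (family_heq g.1 hτ' ?_)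
      refine HEq.trans ?_ (A.tr_heq _ _).symm
      refine (A.act_heq rfl (by simp [ι]) rfl (e σ) (A.tr_heq _ _)).trans ?_
      refine (A.act_act_heq hτ _ _ rfl _).trans (A.act_act_heq rfl _ _ _ _).symm
    refine ⟨⟨f, hnat⟩, ?_⟩
    apply Subtype.ext
    funext Q ρ a
    have e2 : F.map ρ (F.map ι x) = F.map (ι ≫ ρ) x := by simp [ι]
    let r : up Q ⟶ Q := TimeObj.extend (𝟙 Q) (ρ.fn (P.newClock l hl n))
      ((TimeObj.Hom.le ρ _).trans TimeObj.time_newClock.le)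
    have hr : j Q ≫ r = 𝟙 Q := TimeObj.addIncl_extend _ _ _
    have hr' : lift (ι ≫ ρ) ≫ r = ρ := by
      apply TimeObj.addClock_ext
      · change ι ≫ _ = ι ≫ _
        rw [← Category.assoc, hlift, Category.assoc, hr, Category.comp_id]
      · rw [TimeObj.comp_fn, hlift']
        exact TimeObj.extend_newClock _ _ _
    have key := g.2 _ _ (lift (ι ≫ ρ)) r
      (A.tr (e _).symm (A.act (j Q) rfl (A.tr e2 a)))
    apply eq_of_heq
    refine (precomp_heq A B ι rfl f rfl (a' := A.tr e2 a) (A.tr_heq _ _).symm).trans ?_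
    have e3 : A.total.map (𝟙 Q) ⟨F.map (ι ≫ ρ) x, A.tr e2 a⟩ = ⟨F.map (ι ≫ ρ) x, A.tr e2 a⟩ := by
      rw [A.total.map_id]; rfl
    refine (heq_of_eq (B.act_id e3 _)).symm.trans ?_
    refine (B.act_act_heq hr rfl rfl e3 _).symm.trans ?_
    refine (B.act_heq rfl rfl (A.total_map (y := F.map (lift (ι ≫ ρ) ≫ r) (F.map ι x)) _ (by simp [ι]) _)
      (A.total_tr _ _).symm (hf _ _ _)).trans ?_
    refine (heq_of_eq key).trans (family_heq g.1 hr' ?_)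
    refine (A.act_heq rfl (by simp [ι]) rfl (e _) (A.tr_heq _ _)).trans ?_
    have e4 : F.map (𝟙 Q) (F.map (ι ≫ ρ) x) = F.map (ι ≫ ρ) x := by simp [ι]
    refine (A.act_act_heq hr _ _ e4 _).trans ?_
    exact (heq_of_eq (A.act_id _ _)).trans (A.tr_heq _ _)

end PTy

/-- Precomposition with `f : P ⟶ Q`, as a map `y Q ⟶ y P`. -/
def yoMap {P Q : TimeObj Clk} (f : P ⟶ Q) : PMap (yo Q) (yo P) where
  app σ := f ≫ σ
  nat g σ := Category.assoc f σ g

section Universes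

variable [DecidableEq Clk]

/-- Small dependent types over `y P` that are invariant under clock introduction. -/
abbrev SmallTy (P : TimeObj Clk) : Type (u + 1) := {X : PTy.{u} (yo P) // X.Invariant}

/-- The small type `σ ↦ X_{σ ∘ f}` for `f : P ⟶ Q`. -/
def SmallTy.restrict {P Q : TimeObj Clk} (f : P ⟶ Q) (X : SmallTy.{u} P) : SmallTy.{u} Q :=
  ⟨X.1.subst (yoMap f), X.2.subst _⟩

/-- The object `C^D`, a `D`-fold product of the object of clocks `C(E, δ) = E`. -/
abbrev clockPow (D : Type) : TimeObj Clk ⥤ Type where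
  obj P := D → P.clocks
  map σ := TypeCat.ofHom fun g d => σ.fn (g d)

/-- The universe: the dependent type over `C^D` of small types on `y(g[D], δ|g[D])` that are
invariant under clock introduction. -/
def USem (D : Type) [Fintype D] : PTy.{u + 1} (clockPow D : TimeObj Clk ⥤ Type) where
  fam {P} g := SmallTy.{u} (P.im g)
  act σ _ _ h X := X.restrict (TimeObj.cores σ h)
  act_id _ _ := rfl
  act_comp _ _ _ _ _ _ _ _ _ := rfl

/-- The action of `τ : Q ⟶ Q'` on a small type `X` over `y(g[D], δ|g[D])`, as a map `X_σ → X'_{σ'}`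
where `X' = ω · X` and `σ' ∘ ω̄ = τ ∘ σ` for the restriction and corestriction `ω̄` of `ω`: then
`X'_{σ'} = X_{σ' ∘ ω̄} = X_{τ ∘ σ}`. -/
def slide {D : Type} [Fintype D] {P P' Q Q' : TimeObj Clk} {ω : P ⟶ P'}
    {g : (clockPow D).obj P} {g' : (clockPow D).obj P'} {h : (clockPow D).map ω g = g'}
    {X : SmallTy.{u} (P.im g)} {X' : SmallTy.{u} (P'.im g')} (e : (USem D).act ω h X = X')
    (σ : P.im g ⟶ Q) (σ' : P'.im g' ⟶ Q') (τ : Q ⟶ Q')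
    (hτ : TimeObj.cores ω h ≫ σ' = σ ≫ τ) (a : X.1.fam σ) : X'.1.fam σ' :=
  e ▸ (X.1.act τ hτ.symm a : X.1.fam (TimeObj.cores ω h ≫ σ'))

theorem slide_heq {D : Type} [Fintype D] {P P' Q Q' : TimeObj Clk} {ω : P ⟶ P'}
    {g : (clockPow D).obj P} {g' : (clockPow D).obj P'} {h : (clockPow D).map ω g = g'}
    {X : SmallTy.{u} (P.im g)} {X' : SmallTy.{u} (P'.im g')} (e : (USem D).act ω h X = X')
    (σ : P.im g ⟶ Q) (σ' : P'.im g' ⟶ Q') (τ : Q ⟶ Q')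
    (hτ : TimeObj.cores ω h ≫ σ' = σ ≫ τ) (a : X.1.fam σ) :
    HEq (slide e σ σ' τ hτ a) (X.1.act τ hτ.symm a : X.1.fam (TimeObj.cores ω h ≫ σ')) := by
  subst e; rfl

theorem slide_heq' {D : Type} [Fintype D] {P P' Q Q' : TimeObj Clk} {ω : P ⟶ P'}
    {g : (clockPow D).obj P} {g' : (clockPow D).obj P'} {h : (clockPow D).map ω g = g'}
    {X : SmallTy.{u} (P.im g)} {X' : SmallTy.{u} (P'.im g')} (e : (USem D).act ω h X = X')
    (σ : P.im g ⟶ Q) (σ' : P'.im g' ⟶ Q') (τ : Q ⟶ Q')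
    (hτ : TimeObj.cores ω h ≫ σ' = σ ≫ τ) (a : X.1.fam σ) :
    HEq (slide e σ σ' τ hτ a) (X.1.act τ rfl a) :=
  (slide_heq e σ σ' τ hτ a).trans (X.1.act_heq rfl _ _ rfl HEq.rfl)

theorem slide_comp {D : Type} [Fintype D] {P P' P'' Q Q' Q'' : TimeObj Clk}
    {ω : P ⟶ P'} {ω' : P' ⟶ P''}
    {g : (clockPow D).obj P} {g' : (clockPow D).obj P'} {g'' : (clockPow D).obj P''}
    {h : (clockPow D).map ω g = g'} {h' : (clockPow D).map ω' g' = g''}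
    {h'' : (clockPow D).map (ω ≫ ω') g = g''}
    {X : SmallTy.{u} (P.im g)} {X' : SmallTy.{u} (P'.im g')} {X'' : SmallTy.{u} (P''.im g'')}
    (e : (USem D).act ω h X = X') (e' : (USem D).act ω' h' X' = X'')
    (e'' : (USem D).act (ω ≫ ω') h'' X = X'')
    (σ : P.im g ⟶ Q) (σ' : P'.im g' ⟶ Q') (σ'' : P''.im g'' ⟶ Q'') (τ : Q ⟶ Q') (τ' : Q' ⟶ Q'')
    (hτ : TimeObj.cores ω h ≫ σ' = σ ≫ τ) (hτ' : TimeObj.cores ω' h' ≫ σ'' = σ' ≫ τ')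
    (hτ'' : TimeObj.cores (ω ≫ ω') h'' ≫ σ'' = σ ≫ τ ≫ τ') (a : X.1.fam σ) :
    slide e'' σ σ'' (τ ≫ τ') hτ'' a = slide e' σ' σ'' τ' hτ' (slide e σ σ' τ hτ a) := by
  subst e e'
  exact X.1.act_comp _ _ _ _ _ _

/-- The dependent type of elements: `El(g, X) = X_i`, for `i : (g[D], δ|g[D]) ⟶ (E, δ)` the
inclusion. -/
def ElSem (D : Type) [Fintype D] :
    PTy.{u} (USem.{u} D : PTy (clockPow D : TimeObj Clk ⥤ Type)).total where
  fam {P} p := p.2.1.fam (P.imIncl p.1)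
  act {P Q} σ p q h a :=
    slide (h := congrArg Sigma.fst h) (by subst h; rfl) (P.imIncl p.1) (Q.imIncl q.1) σ
      (TimeObj.cores_imIncl σ _) a
  act_id {P p} h a := eq_of_heq ((slide_heq _ _ _ _ _ _).trans (heq_of_eq (p.2.1.act_id _ _)))
  act_comp f g x y z h h' h'' a := slide_comp _ _ _ _ _ _ _ _ _ _ _ _

/-- A context: a covariant presheaf `Γ`, with an element `γ(κ) ∈ E`, naturally in `γ ∈ Γ(E, δ)`, for
every clock variable `κ ∈ K`. -/
structure Ctx (Clk K : Type) where
  psh : TimeObj Clk ⥤ Type w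
  clk : ∀ {P : TimeObj Clk}, psh.obj P → K → P.clocks
  clk_nat : ∀ {P Q : TimeObj Clk} (σ : P ⟶ Q) (γ : psh.obj P) (κ : K),
    σ.fn (clk γ κ) = clk (psh.map σ γ) κ

namespace Ctx

variable {K : Type}

/-- The extension of a context by a variable of type `A`. -/
abbrev ext (Γ : Ctx.{w} Clk K) (A : PTy.{v} Γ.psh) : Ctx.{max w v} Clk K where
  psh := A.total
  clk p := Γ.clk p.1
  clk_nat σ p := Γ.clk_nat σ p.1

/-- The map `γ ↦ γ|Δ` from `Γ` to `C^Δ`. -/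
def clkMap (Γ : Ctx.{w} Clk K) (Δ : Finset K) : PMap Γ.psh (clockPow Δ) where
  app γ κ := Γ.clk γ κ
  nat σ γ := funext fun κ => Γ.clk_nat σ γ κ

/-- The universe `U_Δ` in context `Γ`: at `γ` it consists of the small types over
`y(γ[Δ], δ|γ[Δ])` that are invariant under clock introduction. -/
abbrev U (Γ : Ctx.{w} Clk K) (Δ : Finset K) : PTy.{u + 1} Γ.psh := (USem.{u} Δ).subst (Γ.clkMap Δ)

end Ctx

variable {K : Type} {Γ : Ctx.{w} Clk K} {Δ Δ' : Finset K}

/-- The map `γ ↦ (γ|Δ, t(γ))`. -/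
def uMap (t : Tm Γ.psh (Γ.U Δ)) : PMap Γ.psh (USem.{u} Δ).total where
  app γ := ⟨(Γ.clkMap Δ).app γ, t.app γ⟩
  nat σ γ := by
    exact ((USem Δ).total_map σ ((Γ.clkMap Δ).nat σ γ) (t.app γ)).trans
      (congrArg (Sigma.mk _) (t.nat σ rfl))

/-- `El_Δ(t)`, with `El_Δ(t)(γ) = t(γ)_i` for the inclusion `i : (γ[Δ], δ|γ[Δ]) ⟶ (E, δ)`. -/
abbrev El (t : Tm Γ.psh (Γ.U Δ)) : PTy.{u} Γ.psh := (ElSem.{u} Δ).subst (uMap t)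

/-- The inclusion `j : (γ[Δ], δ|γ[Δ]) ⟶ (γ[Δ'], δ|γ[Δ'])` for `Δ ⊆ Δ'`. -/
def imSub {P : TimeObj Clk} (h : Δ ⊆ Δ') (γ : Γ.psh.obj P) :
    P.im ((Γ.clkMap Δ).app γ) ⟶ P.im ((Γ.clkMap Δ').app γ) :=
  TimeObj.incl _ _ (fun l hl => by
    obtain ⟨⟨κ, hκ⟩, e⟩ := TimeObj.mem_im.1 hl
    exact TimeObj.mem_im.2 ⟨⟨κ, h hκ⟩, e⟩) (fun _ => le_rfl)

/-- The universe inclusion from `U_Δ` to `U_Δ'`, given by `in(t)(γ)_σ = t(γ)_{σ ∘ j}` for the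
inclusion `j : (γ[Δ], δ|γ[Δ]) ⟶ (γ[Δ'], δ|γ[Δ'])`. -/
def inU (h : Δ ⊆ Δ') (t : Tm.{u+1} Γ.psh (Γ.U Δ)) : Tm Γ.psh (Γ.U Δ') where
  app γ := SmallTy.restrict (imSub h γ) (t.app γ)
  nat σ x y k := by
    rw [← t.nat σ k]
    subst k
    rfl

theorem El_act_heq (t : Tm.{u+1} Γ.psh (Γ.U Δ)) {P Q : TimeObj Clk} (f : P ⟶ Q)
    {x : Γ.psh.obj P} {y : Γ.psh.obj Q} (k : Γ.psh.map f x = y) (a : (El t).fam x) :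
    HEq ((El t).act f k a) ((t.app x).1.act f rfl a) :=
  slide_heq _ _ _ _ (TimeObj.cores_imIncl f _) _

theorem El_inU (h : Δ ⊆ Δ') (t : Tm.{u+1} Γ.psh (Γ.U Δ)) : El (inU h t) = El t := by
  refine PTy.ext_heq (fun _ _ => rfl) ?_
  intro P Q f x y k a b hab
  cases hab
  exact (El_act_heq (inU h t) f k a).trans (El_act_heq t f k a).symm

/-- For `B : U_Δ` in context `Γ, x : El_Δ(A)`, the term `in(B) : U_Δ'` in context
`Γ, x : El_Δ'(in(A))`. The two contexts are equal since `El_Δ'(in(A)) = El_Δ(A)`. -/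
def inUFam (h : Δ ⊆ Δ') (A : Tm.{u + 1} Γ.psh (Γ.U Δ))
    (B : Tm.{u + 1} (Γ.ext (El A)).psh ((Γ.ext (El A)).U Δ)) :
    Tm.{u + 1} (Γ.ext (El (inU h A))).psh ((Γ.ext (El (inU h A))).U Δ') where
  app p := (inU h B).app ⟨p.1, p.2⟩
  nat f p q k := (inU h B).nat f (x := ⟨p.1, p.2⟩) (y := ⟨q.1, q.2⟩) (by
    subst k
    refine congrArg (Sigma.mk _) (eq_of_heq ?_)
    exact (El_act_heq A f rfl p.2).trans (El_act_heq (inU h A) f rfl p.2).symm)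

/-- The element `τ · x` of `El_Δ(A)(ω · γ)` for `σ : (γ[Δ], δ|γ[Δ]) ⟶ Q`, `x ∈ A(γ)_σ` and
`τ : Q ⟶ R`, where `ω` and `τ ∘ σ` agree on `γ[Δ]`: then `A(γ)_{τ ∘ σ} = El_Δ(A)(ω · γ)`. -/
def toEl (A : Tm.{u + 1} Γ.psh (Γ.U Δ)) {P Q R : TimeObj Clk} {γ : Γ.psh.obj P}
    {γ' : Γ.psh.obj R} (ω : P ⟶ R) (k : Γ.psh.map ω γ = γ')
    (σ : P.im ((Γ.clkMap Δ).app γ) ⟶ Q) (τ : Q ⟶ R) (hτ : P.imIncl _ ≫ ω = σ ≫ τ)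
    (x : (A.app γ).1.fam σ) : (El A).fam γ' :=
  slide (h := by rw [← k]; exact (Γ.clkMap Δ).nat ω γ) (A.nat ω k) σ (R.imIncl _) τ hτ x

theorem El_act_toEl (A : Tm.{u + 1} Γ.psh (Γ.U Δ)) {P Q R S : TimeObj Clk} {γ : Γ.psh.obj P}
    {γ' : Γ.psh.obj R} {γ'' : Γ.psh.obj S} (ω : P ⟶ R) (k : Γ.psh.map ω γ = γ')
    (σ : P.im ((Γ.clkMap Δ).app γ) ⟶ Q) (τ : Q ⟶ R) (hτ : P.imIncl _ ≫ ω = σ ≫ τ)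
    (x : (A.app γ).1.fam σ) (f : R ⟶ S) (k' : Γ.psh.map f γ' = γ'') :
    (El A).act f k' (toEl A ω k σ τ hτ x) = toEl A (ω ≫ f) (by simp [k, k']) σ (τ ≫ f)
      (by rw [← Category.assoc, hτ, Category.assoc]) x :=
  (slide_comp _ _ _ _ _ _ _ _ _ (TimeObj.cores_imIncl f _) _ _).symm

theorem toEl_act (A : Tm.{u + 1} Γ.psh (Γ.U Δ)) {P Q Q' R : TimeObj Clk} {γ : Γ.psh.obj P}
    {γ' : Γ.psh.obj R} (ω : P ⟶ R) (k : Γ.psh.map ω γ = γ')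
    (σ : P.im ((Γ.clkMap Δ).app γ) ⟶ Q) (ρ : Q ⟶ Q') (τ : Q' ⟶ R)
    (hτ : P.imIncl _ ≫ ω = (σ ≫ ρ) ≫ τ) (x : (A.app γ).1.fam σ) :
    toEl A ω k (σ ≫ ρ) τ hτ ((A.app γ).1.act ρ rfl x) =
      toEl A ω k σ (ρ ≫ τ) (by rw [hτ, Category.assoc]) x := by
  refine eq_of_heq ((slide_heq _ _ _ _ _ _).trans ?_)
  refine HEq.trans ?_ (slide_heq _ _ _ _ _ _).symm
  exact heq_of_eq ((A.app γ).1.act_comp _ _ _ _ _ _).symm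

end Universes

/-- A choice of binary coproducts of finite sets of clocks whose left inclusions are set
inclusions: `E + E'` is a finite set of clocks, with a bijection from the disjoint union (that is, a
coproduct cocone), such that `inl(l) = l` for all `l ∈ E`. -/
structure ClockSum (Clk : Type) where
  sum : Finset Clk → Finset Clk → Finset Clk
  equiv : ∀ E E' : Finset Clk, E ⊕ E' ≃ sum E E'
  inl_eq : ∀ (E E' : Finset Clk) (l : E), (equiv E E' (Sum.inl l) : Clk) = l

/-- Such a choice exists as soon as there are infinitely many clocks. -/
theorem ClockSum.nonempty [Infinite Clk] : Nonempty (ClockSum Clk) := by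
  classical
  have key : ∀ E E' : Finset Clk, ∃ (S : Finset Clk) (e : E ⊕ E' ≃ S),
      ∀ l : E, (e (Sum.inl l) : Clk) = l := by
    intro E E'
    obtain ⟨T, hT, hc⟩ := E.finite_toSet.infinite_compl.exists_subset_card_eq E'.card
    have hd : Disjoint E T := Finset.disjoint_left.2 fun l hl hl' => hT hl' hl
    let e₀ : E' ≃ T := Finset.equivOfCardEq hc.symm
    refine ⟨E ∪ T, (Equiv.sumCongr (Equiv.refl _) e₀).trans (Equiv.Finset.union E T hd), ?_⟩
    intro l
    simp
  choose S e he using key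
  exact ⟨⟨S, e, he⟩⟩

namespace ClockSum

variable (cp : ClockSum Clk)

/-- The time object `(E + E', [δ, δ'])`. -/
def sumObj (Q P : TimeObj Clk) : TimeObj Clk where
  clocks := cp.sum Q.clocks P.clocks
  time l := Sum.elim Q.time P.time ((cp.equiv _ _).symm l)

/-- The left inclusion `(E, δ) ⟶ (E + E', [δ, δ'])`. -/
def inl (Q P : TimeObj Clk) : Q ⟶ cp.sumObj Q P where
  fn l := cp.equiv _ _ (Sum.inl l)
  le l := by simp [sumObj]

theorem inl_val {Q P : TimeObj Clk} (q : Q.clocks) : ((cp.inl Q P).fn q : Clk) = q :=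
  cp.inl_eq _ _ q

theorem time_inl {Q P : TimeObj Clk} (q : Q.clocks) :
    (cp.sumObj Q P).time ((cp.inl Q P).fn q) = Q.time q := by
  simp [sumObj, inl]

/-- The right inclusion `(E', δ') ⟶ (E + E', [δ, δ'])`. -/
def inr (Q P : TimeObj Clk) : P ⟶ cp.sumObj Q P where
  fn l := cp.equiv _ _ (Sum.inr l)
  le l := by simp [sumObj]

/-- The copairing `[f, g]`. -/
def copair {Q P R : TimeObj Clk} (f : Q ⟶ R) (g : P ⟶ R) : cp.sumObj Q P ⟶ R where
  fn l := Sum.elim f.fn g.fn ((cp.equiv _ _).symm l)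
  le l := by
    obtain ⟨m, rfl⟩ := (cp.equiv _ _).surjective l
    rcases m with m | m
    · simpa [sumObj] using TimeObj.Hom.le f m
    · simpa [sumObj] using TimeObj.Hom.le g m

@[simp] theorem inl_copair {Q P R : TimeObj Clk} (f : Q ⟶ R) (g : P ⟶ R) :
    cp.inl Q P ≫ cp.copair f g = f :=
  TimeObj.hom_ext fun l => by simp [inl, copair]

@[simp] theorem inr_copair {Q P R : TimeObj Clk} (f : Q ⟶ R) (g : P ⟶ R) :
    cp.inr Q P ≫ cp.copair f g = g :=
  TimeObj.hom_ext fun l => by simp [inr, copair]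

theorem inl_cancel {P Q R : TimeObj Clk} {f g : R ⟶ Q}
    (h : f ≫ cp.inl Q P = g ≫ cp.inl Q P) : f = g := by
  refine TimeObj.hom_ext fun l => Subtype.ext ?_
  have e := congrArg (fun k : R ⟶ cp.sumObj Q P => (k.fn l : Clk)) h
  exact (cp.inl_val (P := P) _).symm.trans (e.trans (cp.inl_val (P := P) _))

variable [DecidableEq Clk]

/-- The map `σ + i : (E, δ) ⟶ (E' + E, [δ', δ])` for `σ : (g[D], δ|g[D]) ⟶ (E', δ')` and the
inclusion `i` of `E \ g[D]` in `E`: it maps `l ∈ g[D]` to `inl(σ(l))` and the other `l` to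
`inr(l)`. -/
def extendMap {D : Type} [Fintype D] {P Q : TimeObj Clk} {g : D → P.clocks} (σ : P.im g ⟶ Q) :
    P ⟶ cp.sumObj Q P where
  fn l := if h : l.1 ∈ (P.im g).clocks then (cp.inl Q P).fn (σ.fn ⟨l.1, h⟩) else (cp.inr Q P).fn l
  le l := by
    split_ifs with h
    · exact (TimeObj.Hom.le (cp.inl Q P) _).trans (TimeObj.Hom.le σ ⟨l.1, h⟩)
    · exact TimeObj.Hom.le (cp.inr Q P) l

theorem extendMap_of_mem {D : Type} [Fintype D] {P Q : TimeObj Clk} {g : D → P.clocks}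
    (σ : P.im g ⟶ Q) {l : P.clocks} (h : l.1 ∈ (P.im g).clocks) :
    (cp.extendMap σ).fn l = (cp.inl Q P).fn (σ.fn ⟨l.1, h⟩) := dif_pos h

theorem extendMap_of_notMem {D : Type} [Fintype D] {P Q : TimeObj Clk} {g : D → P.clocks}
    (σ : P.im g ⟶ Q) {l : P.clocks} (h : l.1 ∉ (P.im g).clocks) :
    (cp.extendMap σ).fn l = (cp.inr Q P).fn l := dif_neg h

theorem imIncl_extendMap {D : Type} [Fintype D] {P Q : TimeObj Clk} {g : D → P.clocks}
    (σ : P.im g ⟶ Q) : P.imIncl g ≫ cp.extendMap σ = σ ≫ cp.inl Q P :=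
  TimeObj.hom_ext fun l => cp.extendMap_of_mem σ l.2

/-- The inclusion `(g[D], [δ', δ]|g[D]) ⟶ (E', δ')` for a map `g : D → E' + E` that factors
through `inl`. -/
def leftIncl {D : Type} [Fintype D] {P Q : TimeObj Clk} {g : D → (cp.sumObj Q P).clocks}
    (hg : ∀ d, ∃ q, (cp.inl Q P).fn q = g d) : (cp.sumObj Q P).im g ⟶ Q :=
  TimeObj.incl _ _
    (fun l hl => by
      obtain ⟨d, rfl⟩ := TimeObj.mem_im.1 hl
      obtain ⟨q, hq⟩ := hg d
      rw [← hq, cp.inl_val]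
      exact q.2)
    (fun l => by
      obtain ⟨d, hd⟩ := TimeObj.mem_im.1 l.2
      obtain ⟨q, hq⟩ := hg d
      have e : (cp.inl Q P).fn q = ((cp.sumObj Q P).imIncl g).fn l :=
        Subtype.ext (by rw [hq, hd]; rfl)
      change _ ≤ (cp.sumObj Q P).time (((cp.sumObj Q P).imIncl g).fn l)
      rw [← e, cp.time_inl]
      refine le_of_eq (congrArg _ (Subtype.ext ?_))
      exact hd.symm.trans ((congrArg Subtype.val hq).symm.trans (cp.inl_val q)))

theorem leftIncl_inl {D : Type} [Fintype D] {P Q : TimeObj Clk}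
    {g : D → (cp.sumObj Q P).clocks} (hg : ∀ d, ∃ q, (cp.inl Q P).fn q = g d) :
    cp.leftIncl hg ≫ cp.inl Q P = (cp.sumObj Q P).imIncl g :=
  TimeObj.hom_ext fun _ => Subtype.ext (cp.inl_val _)

theorem cores_leftIncl {D : Type} [Fintype D] {P Q P' Q' : TimeObj Clk}
    {g : D → (cp.sumObj Q P).clocks} {g' : D → (cp.sumObj Q' P').clocks}
    (hg : ∀ d, ∃ q, (cp.inl Q P).fn q = g d) (hg' : ∀ d, ∃ q, (cp.inl Q' P').fn q = g' d)
    (φ : cp.sumObj Q P ⟶ cp.sumObj Q' P') (τ : Q ⟶ Q') (hφ : cp.inl Q P ≫ φ = τ ≫ cp.inl Q' P')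
    (h : (fun d => φ.fn (g d)) = g') :
    TimeObj.cores φ h ≫ cp.leftIncl hg' = cp.leftIncl hg ≫ τ := by
  apply cp.inl_cancel (P := P')
  rw [Category.assoc, cp.leftIncl_inl, TimeObj.cores_imIncl, ← cp.leftIncl_inl hg, Category.assoc,
    hφ, Category.assoc]

end ClockSum

section Codes

variable [DecidableEq Clk] (cp : ClockSum Clk) {K : Type} {Γ : Ctx.{w} Clk K} {Δ Δ' : Finset K}
  (A : Tm.{u + 1} Γ.psh (Γ.U Δ)) (B : Tm.{u + 1} (Γ.ext (El A)).psh ((Γ.ext (El A)).U Δ))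

/-- The point `((σ + i) · γ, inl · x)` of `Γ, x : El_Δ(A)` at `(E' + E, [δ', δ])`, for
`γ ∈ Γ(E, δ)`, `σ : (γ[Δ], δ|γ[Δ]) ⟶ (E', δ')` and `x ∈ A(γ)_σ`. -/
def extPt {P Q : TimeObj Clk} (γ : Γ.psh.obj P) (σ : P.im ((Γ.clkMap Δ).app γ) ⟶ Q)
    (x : (A.app γ).1.fam σ) : (Γ.ext (El A)).psh.obj (cp.sumObj Q P) :=
  ⟨Γ.psh.map (cp.extendMap σ) γ,
    toEl A (cp.extendMap σ) rfl σ (cp.inl Q P) (cp.imIncl_extendMap σ) x⟩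

theorem extPt_clk {P Q : TimeObj Clk} (γ : Γ.psh.obj P) (σ : P.im ((Γ.clkMap Δ).app γ) ⟶ Q)
    (x : (A.app γ).1.fam σ) (κ : Δ) :
    ∃ q, (cp.inl Q P).fn q = ((Γ.ext (El A)).clkMap Δ).app (extPt cp A γ σ x) κ := by
  have hκ : (Γ.clk γ κ : Clk) ∈ (P.im ((Γ.clkMap Δ).app γ)).clocks := TimeObj.mem_im.2 ⟨κ, rfl⟩
  refine ⟨σ.fn ⟨_, hκ⟩, ?_⟩
  refine Eq.trans ?_ (Γ.clk_nat (cp.extendMap σ) γ κ)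
  exact (cp.extendMap_of_mem σ (l := Γ.clk γ κ) hκ).symm

theorem map_extPt {P Q R : TimeObj Clk} {γ : Γ.psh.obj P} {γ' : Γ.psh.obj R}
    (σ : P.im ((Γ.clkMap Δ).app γ) ⟶ Q) (x : (A.app γ).1.fam σ) (f : cp.sumObj Q P ⟶ R)
    (ω : P ⟶ R) (hω : cp.extendMap σ ≫ f = ω) (k : Γ.psh.map ω γ = γ')
    (τ : Q ⟶ R) (hτ : cp.inl Q P ≫ f = τ) :
    (Γ.ext (El A)).psh.map f (extPt cp A γ σ x) = ⟨γ', toEl A ω k σ τ (by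
      rw [← hω, ← hτ, ← Category.assoc, cp.imIncl_extendMap, Category.assoc]) x⟩ := by
  subst hω hτ
  refine ((El A).total_map f (y := γ') (by rw [← k, Γ.psh.map_comp]; rfl) _).trans ?_
  exact congrArg (Sigma.mk _) (El_act_toEl A _ rfl σ _ _ x f _)

/-- The map `τ + id`. -/
def ClockSum.mapLeft {Q R : TimeObj Clk} (τ : Q ⟶ R) (P : TimeObj Clk) :
    cp.sumObj Q P ⟶ cp.sumObj R P := cp.copair (τ ≫ cp.inl R P) (cp.inr R P)

theorem ClockSum.extendMap_copair {D : Type} [Fintype D] {P Q R : TimeObj Clk} {g : D → P.clocks}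
    (σ : P.im g ⟶ Q) (f : Q ⟶ R) (h : P ⟶ R) (w : P ⟶ R) (hw : P.imIncl g ≫ w = σ ≫ f)
    (hw' : ∀ l : P.clocks, (l : Clk) ∉ (P.im g).clocks → w.fn l = h.fn l) :
    cp.extendMap σ ≫ cp.copair f h = w := by
  refine TimeObj.hom_ext fun l => ?_
  by_cases hl : (l : Clk) ∈ (P.im g).clocks
  · rw [TimeObj.comp_fn, cp.extendMap_of_mem σ hl, ← TimeObj.comp_fn, cp.inl_copair]
    exact (congrArg (fun k : P.im g ⟶ R => k.fn ⟨l.1, hl⟩) hw).symm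
  · rw [TimeObj.comp_fn, cp.extendMap_of_notMem σ hl, ← TimeObj.comp_fn, cp.inr_copair, hw' l hl]

theorem ClockSum.extendMap_mapLeft {D : Type} [Fintype D] {P Q R : TimeObj Clk} {g : D → P.clocks}
    (σ : P.im g ⟶ Q) (τ : Q ⟶ R) :
    cp.extendMap σ ≫ cp.mapLeft τ P = cp.extendMap (σ ≫ τ) := by
  refine cp.extendMap_copair _ _ _ _ ?_ fun l hl => cp.extendMap_of_notMem _ hl
  rw [cp.imIncl_extendMap, Category.assoc]

theorem extPt_map {P Q R : TimeObj Clk} (γ : Γ.psh.obj P)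
    (σ : P.im ((Γ.clkMap Δ).app γ) ⟶ Q) (τ : Q ⟶ R) (x : (A.app γ).1.fam σ) :
    (Γ.ext (El A)).psh.map (cp.mapLeft τ P) (extPt cp A γ σ x) =
      extPt cp A γ (σ ≫ τ) ((A.app γ).1.act τ rfl x) := by
  refine (map_extPt cp A σ x _ _ (cp.extendMap_mapLeft σ τ) rfl (τ ≫ cp.inl R P)
    (cp.inl_copair _ _)).trans ?_
  exact congrArg (Sigma.mk _) (toEl_act A _ rfl σ τ _ _ x).symm

theorem extPt_total {P Q R : TimeObj Clk} (γ : Γ.psh.obj P) (τ : Q ⟶ R)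
    {p : (A.app γ).1.total.obj Q} {q : (A.app γ).1.total.obj R}
    (h : (A.app γ).1.total.map τ p = q) :
    (Γ.ext (El A)).psh.map (cp.mapLeft τ P) (extPt cp A γ p.1 p.2) = extPt cp A γ q.1 q.2 := by
  subst h
  exact extPt_map cp A γ p.1 τ p.2

/-- The inclusion `j : ((σ + i)γ[Δ], [δ', δ]|(σ + i)γ[Δ]) ⟶ (E', δ')`. -/
def extIncl {P Q : TimeObj Clk} (γ : Γ.psh.obj P) (σ : P.im ((Γ.clkMap Δ).app γ) ⟶ Q)
    (x : (A.app γ).1.fam σ) :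
    (cp.sumObj Q P).im (((Γ.ext (El A)).clkMap Δ).app (extPt cp A γ σ x)) ⟶ Q :=
  cp.leftIncl (extPt_clk cp A γ σ x)

/-- The dependent type `(x : A) . B` at `γ`, over the type `A(γ)`. With
`σ : (γ[Δ], δ|γ[Δ]) ⟶ (E', δ')`, `x ∈ A(γ)_σ` and the inclusion `j` of `(σ + i)γ[Δ] = σγ[Δ]` in `E'`,
`((x : A) . B)(γ)_σ(x) = B((σ + i) · γ, inl · x)_j`. A morphism `τ : (E', δ') ⟶ (E'', δ'')` acts by the
action of `τ` on the small type `B((σ + i) · γ, inl · x)`, which lands in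
`B((σ + i) · γ, inl · x)_{τ ∘ j} = B((τσ + i) · γ, inl · τ · x)_{j'}` by naturality of `B` along
`τ + id`. -/
def depTy {P : TimeObj Clk} (γ : Γ.psh.obj P) : PTy.{u} (A.app γ).1.total where
  fam p := (B.app (extPt cp A γ p.1 p.2)).1.fam (extIncl cp A γ p.1 p.2)
  act {Q R} τ p q h :=
    slide (ω := cp.mapLeft τ P)
      (h := (((Γ.ext (El A)).clkMap Δ).nat _ _).trans (congrArg _ (extPt_total cp A γ τ h)))
      (B.nat (cp.mapLeft τ P) (extPt_total cp A γ τ h))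
      (extIncl cp A γ p.1 p.2) (extIncl cp A γ q.1 q.2) τ
      (cp.cores_leftIncl _ _ _ _ (cp.inl_copair _ _) _)
  act_id {Q p} h y :=
    eq_of_heq ((slide_heq' _ _ _ _ _ _).trans
      ((PTy.act_heq _ rfl rfl (Category.comp_id (extIncl cp A γ p.1 p.2)) rfl HEq.rfl).trans
      (heq_of_eq ((B.app (extPt cp A γ p.1 p.2)).1.act_id _ y))))
  act_comp {Q R S} f g p q r h h' h'' y := by
    refine eq_of_heq ((slide_heq' _ _ _ _ _ _).trans (HEq.symm ?_))
    have e := (congrArg ((Γ.ext (El A)).psh.map (cp.mapLeft g P))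
      (extPt_total cp A γ f h)).trans (extPt_total cp A γ g h')
    have e' : (Γ.ext (El A)).psh.map (cp.mapLeft f P ≫ cp.mapLeft g P) (extPt cp A γ p.1 p.2) =
      extPt cp A γ r.1 r.2 := by rw [(Γ.ext (El A)).psh.map_comp]; exact e
    refine HEq.trans (heq_of_eq (slide_comp (h'' := (((Γ.ext (El A)).clkMap Δ).nat _ _).trans (congrArg _ e')) _ _
      (B.nat _ e') _ _ _ _ _ _ _ ?_ _).symm) (slide_heq' _ _ _ _ _ _)
    refine cp.cores_leftIncl _ _ _ _ ?_ _
    rw [← Category.assoc, ClockSum.mapLeft, ClockSum.mapLeft, cp.inl_copair, Category.assoc, cp.inl_copair, Category.assoc]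

theorem depTy_invariant {P : TimeObj Clk} (γ : Γ.psh.obj P) : (depTy cp A B γ).Invariant := by
  intro Q l hl n p
  have key : ∀ {D : Type} [Fintype D] {P P' Q Q' : TimeObj Clk} {ω : P ⟶ P'}
    {g : (clockPow D).obj P} {g' : (clockPow D).obj P'} {h : (clockPow D).map ω g = g'}
    {X : SmallTy.{u} (P.im g)} {X' : SmallTy.{u} (P'.im g')} (e : (USem D).act ω h X = X')
    (σ : P.im g ⟶ Q) (σ' : P'.im g' ⟶ Q') (τ : Q ⟶ Q')
    (hτ : TimeObj.cores ω h ≫ σ' = σ ≫ τ)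
    (_ : Function.Bijective (X.1.act (x := σ) τ hτ.symm)),
    Function.Bijective (slide e σ σ' τ hτ) := by
    intro D _ P P' Q Q' ω g g' h X X' e σ σ' τ hτ hb
    subst e
    exact hb
  exact key _ _ _ _ (cp.cores_leftIncl _ _ _ _ (cp.inl_copair _ _) _)
    ((B.app (extPt cp A γ p.1 p.2)).2.act _)

theorem SmallTy.restrict_fam {P Q R : TimeObj Clk} {f : P ⟶ Q} {X : SmallTy.{u} P}
    {X' : SmallTy.{u} Q} (e : X.restrict f = X') {σ : Q ⟶ R} {σ' : P ⟶ R} (h : f ≫ σ = σ') :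
    X'.1.fam σ = X.1.fam σ' := by
  subst e h; rfl

theorem SmallTy.restrict_act {P Q R S : TimeObj Clk} {f : P ⟶ Q} {X : SmallTy.{u} P}
    {X' : SmallTy.{u} Q} (e : X.restrict f = X') {σ : Q ⟶ R} {σ' : P ⟶ R} (h : f ≫ σ = σ')
    (τ : R ⟶ S) {a : X'.1.fam σ} {a' : X.1.fam σ'} (ha : HEq a a') :
    HEq (X'.1.act τ (rfl : _ = σ ≫ τ) a) (X.1.act τ (rfl : _ = σ' ≫ τ) a') := by
  subst e h ha; rfl

theorem depTy_act_heq {P Q R : TimeObj Clk} (γ : Γ.psh.obj P) (τ : Q ⟶ R)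
    {p : (A.app γ).1.total.obj Q} {q : (A.app γ).1.total.obj R}
    (h : (A.app γ).1.total.map τ p = q) (y : (depTy cp A B γ).fam p) :
    HEq ((depTy cp A B γ).act τ h y)
      ((B.app (extPt cp A γ p.1 p.2)).1.act τ (rfl : _ = extIncl cp A γ p.1 p.2 ≫ τ) y) :=
  slide_heq' _ _ _ _ (cp.cores_leftIncl _ _ _ _ (cp.inl_copair _ _) _) _

section Naturality

variable {P R : TimeObj Clk} {γ : Γ.psh.obj P} {γ' : Γ.psh.obj R} (ω : P ⟶ R)

theorem cores_clk (k : Γ.psh.map ω γ = γ') : (clockPow Δ).map ω ((Γ.clkMap Δ).app γ) = (Γ.clkMap Δ).app γ' :=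
  ((Γ.clkMap Δ).nat ω γ).trans (congrArg _ k)

variable (k : Γ.psh.map ω γ = γ')

theorem extPt_nat {Q : TimeObj Clk} (σ : R.im ((Γ.clkMap Δ).app γ') ⟶ Q) (x : (A.app γ').1.fam σ)
    (x' : (A.app γ).1.fam (TimeObj.cores ω (cores_clk ω k) ≫ σ)) (hx : HEq x x') :
    (Γ.ext (El A)).psh.map (cp.copair (cp.inl Q R) (ω ≫ cp.extendMap σ))
      (extPt cp A γ (TimeObj.cores ω (cores_clk ω k) ≫ σ) x') = extPt cp A γ' σ x := by
  have hA : SmallTy.restrict (TimeObj.cores ω (cores_clk ω k)) (A.app γ) = A.app γ' := A.nat ω k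
  refine (map_extPt cp A _ x' _ (ω ≫ cp.extendMap σ) (cp.extendMap_copair _ _ _ _ ?_ ?_)
    (γ' := Γ.psh.map (cp.extendMap σ) γ') (by simp [← k]) _ (cp.inl_copair _ _)).trans ?_
  · rw [← Category.assoc, ← TimeObj.cores_imIncl ω (cores_clk ω k), Category.assoc,
      cp.imIncl_extendMap, Category.assoc]
  · exact fun _ _ => rfl
  · refine congrArg (Sigma.mk _) (eq_of_heq ?_)
    refine (slide_heq' _ _ _ _ _ _).trans (HEq.trans ?_ (slide_heq' _ _ _ _ _ _).symm)
    exact (SmallTy.restrict_act hA rfl (cp.inl Q R) hx).symm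

theorem depTy_nat {Q : TimeObj Clk} (σ : R.im ((Γ.clkMap Δ).app γ') ⟶ Q) (x : (A.app γ').1.fam σ)
    (x' : (A.app γ).1.fam (TimeObj.cores ω (cores_clk ω k) ≫ σ)) (hx : HEq x x') :
    ∃ f : (cp.sumObj Q P).im _ ⟶ (cp.sumObj Q R).im _,
      SmallTy.restrict f (B.app (extPt cp A γ _ x')) = B.app (extPt cp A γ' σ x) ∧
      f ≫ extIncl cp A γ' σ x = extIncl cp A γ _ x' := by
  refine ⟨TimeObj.cores _ _, B.nat _ (extPt_nat cp A ω k σ x x' hx), ?_⟩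
  exact (cp.cores_leftIncl _ _ _ (𝟙 Q) (by rw [cp.inl_copair, Category.id_comp]) _).trans
    (Category.comp_id _)

theorem depTy_fam {Q : TimeObj Clk} (σ : R.im ((Γ.clkMap Δ).app γ') ⟶ Q) (x : (A.app γ').1.fam σ)
    (x' : (A.app γ).1.fam (TimeObj.cores ω (cores_clk ω k) ≫ σ)) (hx : HEq x x') :
    (depTy cp A B γ').fam (P := Q) ⟨σ, x⟩ = (depTy cp A B γ).fam (P := Q) ⟨_, x'⟩ := by
  obtain ⟨f, hf, hf'⟩ := depTy_nat cp A B ω k σ x x' hx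
  exact SmallTy.restrict_fam hf hf'

theorem depTy_act {Q S : TimeObj Clk} (τ : Q ⟶ S) (σ : R.im ((Γ.clkMap Δ).app γ') ⟶ Q)
    (x : (A.app γ').1.fam σ)
    (x' : (A.app γ).1.fam (TimeObj.cores ω (cores_clk ω k) ≫ σ)) (hx : HEq x x')
    (y : (depTy cp A B γ').fam (P := Q) ⟨σ, x⟩) (y' : (depTy cp A B γ).fam (P := Q) ⟨_, x'⟩)
    (hy : HEq y y') {p : (A.app γ').1.total.obj S} {q : (A.app γ).1.total.obj S}
    (h : (A.app γ').1.total.map τ ⟨σ, x⟩ = p) (h' : (A.app γ).1.total.map τ ⟨_, x'⟩ = q) :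
    HEq ((depTy cp A B γ').act τ h y) ((depTy cp A B γ).act τ h' y') := by
  obtain ⟨f, hf, hf'⟩ := depTy_nat cp A B ω k σ x x' hx
  exact (depTy_act_heq cp A B γ' τ h y).trans
    ((SmallTy.restrict_act hf hf' τ hy).trans (depTy_act_heq cp A B γ τ h' y').symm)

end Naturality

/-- The code `Σ̂ x : A. B : U_Δ`: at `γ` it is the dependent sum, over `y(γ[Δ], δ|γ[Δ])`, of the
dependent type `(x : A) . B` at `γ`. -/
def sigmaCode : Tm.{u + 1} Γ.psh (Γ.U Δ) where
  app γ := ⟨(A.app γ).1.sigma (depTy cp A B γ),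
    PTy.Invariant.sigma (A.app γ).2 (depTy_invariant cp A B γ)⟩
  nat ω γ γ' k := by
    have hA : SmallTy.restrict (TimeObj.cores ω (cores_clk ω k)) (A.app γ) = A.app γ' := A.nat ω k
    refine Subtype.ext (PTy.sigma_subst (s := yoMap _) (congrArg Subtype.val hA.symm) ?_ ?_).symm
    · exact fun Q σ x x' hx => depTy_fam cp A B ω k σ x x' hx
    · exact fun Q S τ σ _ _ x x' hx y y' hy => depTy_act cp A B ω k τ σ x x' hx y y' hy _ _

/-- The code `Π̂ x : A. B : U_Δ`: at `γ` it is the dependent product, over `y(γ[Δ], δ|γ[Δ])`, of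
the dependent type `(x : A) . B` at `γ`. -/
def piCode [Infinite Clk] : Tm.{u + 1} Γ.psh (Γ.U Δ) where
  app γ := ⟨(A.app γ).1.pi (depTy cp A B γ), PTy.Invariant.pi (depTy_invariant cp A B γ)⟩
  nat ω γ γ' k := by
    have hA : SmallTy.restrict (TimeObj.cores ω (cores_clk ω k)) (A.app γ) = A.app γ' := A.nat ω k
    refine Subtype.ext (PTy.pi_subst (s := yoMap _) (congrArg Subtype.val hA.symm) ?_ ?_).symm
    · exact fun Q σ x x' hx => depTy_fam cp A B ω k σ x x' hx
    · exact fun Q S τ σ _ _ x x' hx y y' hy => depTy_act cp A B ω k τ σ x x' hx y y' hy _ _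

end Codes

end ClockModel

open ClockModel

/-!
The point of the argument is that `(x : A) . B` at `γ` may be computed with any extension of `σ` to
all clocks, not only with the canonical one `σ + i : E → E' + E`.

If `ω : E → E'` restricts to `σ` on `γ[Δ]`, the copairing `[id, ω] : E' + E → E'` maps
`((σ + i) · γ, inl · x)` to `(ω · γ, x)`, and it restricts to the inclusion of `σγ[Δ]` in `E'`.
Naturality of `B` along `[id, ω]` therefore identifies `((x : A) . B)(γ)_σ(x)` with
`El(B)(ω · γ, x)`, strictly and with the same actions (`El_depTy_fam`, `El_depTy_act`). A dependent
product or sum of `(x : A) . B` at such a `σ` depends only on these fibres and actions, which gives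
the equations for `El`. That `σ` ranges over the restrictions `ω ∘ j` of arbitrary `ω`, and not over
`j` alone, is what makes the comparison of the presheaf actions go through.

For the universe inclusions, `σ : γ[Δ'] → E'` and its restriction `σk` to `γ[Δ]` have different
extensions: on `γ[Δ'] \ γ[Δ]` the first uses `σ` and the second uses `inr`. The copairing
`[inl, σ + i] : E' + E → E' + E` maps the point for `σk` to the point for `σ`, and fixes `inl`, so
that naturality of `B` along it identifies the two fibres (`inU_depTy_restrict`).
-/

namespace ClockModel

theorem Tm.ext_app {Clk : Type} {F : TimeObj Clk ⥤ Type w} {X : PTy.{v} F} {t t' : Tm F X}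
    (h : ∀ {P : TimeObj Clk} (x : F.obj P), t.app x = t'.app x) : t = t' := by
  obtain ⟨a, _⟩ := t
  obtain ⟨b, _⟩ := t'
  obtain rfl : @a = @b := by
    funext P x
    exact h x
  rfl

section Comparison

variable {Clk : Type} [DecidableEq Clk] (cp : ClockSum Clk) {K : Type} {Γ : Ctx.{w} Clk K}
  {Δ Δ' : Finset K} (A : Tm.{u + 1} Γ.psh (Γ.U Δ))
  (B : Tm.{u + 1} (Γ.ext (El A)).psh ((Γ.ext (El A)).U Δ))

section Elements

variable {P Q : TimeObj Clk} {γ : Γ.psh.obj P} {γ' : Γ.psh.obj Q} {ω : P ⟶ Q}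
  {σ : P.im ((Γ.clkMap Δ).app γ) ⟶ Q} (hσ : P.imIncl _ ≫ ω = σ) (k : Γ.psh.map ω γ = γ')

include hσ k

theorem El_fam : (A.app γ).1.fam σ = (El A).fam γ' :=
  (SmallTy.restrict_fam (f := TimeObj.cores ω (cores_clk ω k)) (A.nat ω k) hσ).symm

theorem El_act {R : TimeObj Clk} (τ : Q ⟶ R) {z : (yo _).obj R} (hz : (yo _).map τ σ = z)
    {γ'' : Γ.psh.obj R} (k' : Γ.psh.map τ γ' = γ'') {x : (A.app γ).1.fam σ} {x' : (El A).fam γ'}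
    (hx : HEq x x') : HEq ((A.app γ).1.act τ hz x) ((El A).act τ k' x') := by
  subst hz
  exact (SmallTy.restrict_act (f := TimeObj.cores ω (cores_clk ω k)) (A.nat ω k) hσ τ
    hx.symm).symm.trans (El_act_heq A τ k' x').symm

/-- Naturality of `B` along `[id, ω]`, which maps `((σ + i) · γ, inl · x)` to `(ω · γ, x)`. -/
theorem El_depTy_restrict (x : (A.app γ).1.fam σ) (x' : (El A).fam γ') (hx : HEq x x') :
    ∃ f : (cp.sumObj Q P).im _ ⟶ Q.im _,
      SmallTy.restrict f (B.app (extPt cp A γ σ x)) =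
        B.app (P := Q) (⟨γ', x'⟩ : (Γ.ext (El A)).psh.obj Q) ∧
      f ≫ Q.imIncl _ = extIncl cp A γ σ x := by
  have hpt : (Γ.ext (El A)).psh.map (cp.copair (𝟙 Q) ω) (extPt cp A γ σ x) = ⟨γ', x'⟩ := by
    refine (map_extPt cp A σ x _ ω (cp.extendMap_copair _ _ _ _
      (hσ.trans (Category.comp_id σ).symm) fun _ _ => rfl) k _ (cp.inl_copair _ _)).trans ?_
    refine congrArg (Sigma.mk _) (eq_of_heq ((slide_heq' _ _ _ _ _ _).trans ?_))
    refine HEq.trans ?_ hx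
    exact ((A.app γ).1.act_heq rfl rfl (Category.comp_id σ) rfl HEq.rfl).trans
      (heq_of_eq ((A.app γ).1.act_id (Category.comp_id σ) x))
  refine ⟨TimeObj.cores _ _, B.nat _ hpt, ?_⟩
  rw [TimeObj.cores_imIncl]
  refine (congrArg (· ≫ cp.copair (𝟙 Q) ω)
    (cp.leftIncl_inl (extPt_clk cp A γ σ x)).symm).trans ?_
  rw [Category.assoc, cp.inl_copair]
  exact Category.comp_id _

theorem El_depTy_fam (x : (A.app γ).1.fam σ) (x' : (El A).fam γ') (hx : HEq x x') :
    (depTy cp A B γ).fam (P := Q) ⟨σ, x⟩ = (El B).fam (P := Q) ⟨γ', x'⟩ := by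
  obtain ⟨f, hf, hf'⟩ := El_depTy_restrict cp A B hσ k x x' hx
  exact (SmallTy.restrict_fam hf hf').symm

theorem El_depTy_act {R : TimeObj Clk} (τ : Q ⟶ R) (x : (A.app γ).1.fam σ) (x' : (El A).fam γ')
    (hx : HEq x x') {p : (A.app γ).1.total.obj R} {q : (Γ.ext (El A)).psh.obj R}
    (hp : (A.app γ).1.total.map τ ⟨σ, x⟩ = p) (hq : (Γ.ext (El A)).psh.map τ ⟨γ', x'⟩ = q)
    {y : (depTy cp A B γ).fam (P := Q) ⟨σ, x⟩} {y' : (El B).fam (P := Q) ⟨γ', x'⟩}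
    (hy : HEq y y') : HEq ((depTy cp A B γ).act τ hp y) ((El B).act τ hq y') := by
  obtain ⟨f, hf, hf'⟩ := El_depTy_restrict cp A B hσ k x x' hx
  exact (depTy_act_heq cp A B γ τ hp y).trans
    ((SmallTy.restrict_act hf hf' τ hy.symm).symm.trans (El_act_heq B τ hq y').symm)

/-- The code of a dependent product at `σ = ω ∘ j` has the same elements as the semantic dependent
product at `ω · γ`; the second part describes how elements correspond, since heterogeneous equality
of families does not reduce to that of their values by itself. -/
theorem El_pi_congr :
    ((A.app γ).1.pi (depTy cp A B γ)).fam σ = ((El A).pi (El B)).fam γ' ∧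
    ∀ (f : ((A.app γ).1.pi (depTy cp A B γ)).fam σ) (f' : ((El A).pi (El B)).fam γ'),
      HEq f f' ↔ ∀ (R : TimeObj Clk) (τ : Q ⟶ R) (a : (A.app γ).1.fam (σ ≫ τ))
        (a' : (El A).fam (Γ.psh.map τ γ')), HEq a a' → HEq (f.1 R τ a) (f'.1 R τ a') := by
  have hc : ∀ {R : TimeObj Clk} (τ : Q ⟶ R), P.imIncl _ ≫ ω ≫ τ = σ ≫ τ := fun τ => by
    rw [← Category.assoc, hσ]
  have kc : ∀ {R : TimeObj Clk} (τ : Q ⟶ R), Γ.psh.map (ω ≫ τ) γ = Γ.psh.map τ γ' := fun τ => by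
    simp [← k]
  exact PTy.pi_congr (fun R τ => El_fam A (hc τ) (kc τ))
    (fun R S τ ρ a a' ha => El_act A (hc τ) (kc τ) ρ _ _ ha)
    (fun R τ a a' ha => El_depTy_fam cp A B (hc τ) (kc τ) a a' ha)
    (fun R S τ ρ a a' ha b b' hb => El_depTy_act cp A B (hc τ) (kc τ) ρ a a' ha _ _ hb)

theorem El_sigma_congr :
    ((A.app γ).1.sigma (depTy cp A B γ)).fam σ = ((El A).sigma (El B)).fam γ' ∧
    ∀ (p : ((A.app γ).1.sigma (depTy cp A B γ)).fam σ) (q : ((El A).sigma (El B)).fam γ'),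
      HEq p q ↔ HEq p.1 q.1 ∧ HEq p.2 q.2 := by
  have key : ∀ {S T : Type u} (_ : S = T) {Y : S → Type u} {Z : T → Type u}
      (_ : ∀ s t, HEq s t → Y s = Z t), (Σ s, Y s) = (Σ t, Z t) ∧
      ∀ (p : Σ s, Y s) (q : Σ t, Z t), HEq p q ↔ HEq p.1 q.1 ∧ HEq p.2 q.2 := by
    rintro S _ rfl Y Z h
    obtain rfl : Y = Z := funext fun s => h s s HEq.rfl
    exact ⟨rfl, fun p q => by rw [heq_iff_eq, heq_iff_eq, Sigma.ext_iff]⟩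
  exact key (El_fam A hσ k) fun a a' ha => El_depTy_fam cp A B hσ k a a' ha

end Elements

theorem El_piCode [Infinite Clk] : El (piCode cp A B) = (El A).pi (El B) := by
  have kid : ∀ {P : TimeObj Clk} (γ : Γ.psh.obj P), Γ.psh.map (𝟙 P) γ = γ := fun γ => by simp
  refine PTy.ext_heq (fun P γ => (El_pi_congr cp A B (Category.comp_id _) (kid γ)).1) ?_
  intro P Q f γ γ' k a b hab
  -- The action of the code lands in its fibre at `j ≫ f`, so the results are compared along `f`, and
  -- the arguments `a`, `b` along the identity.
  refine (El_act_heq (piCode cp A B) f k a).trans ?_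
  refine ((El_pi_congr cp A B rfl k).2 _ _).2 fun R τ c c' hc => ?_
  have e : Γ.psh.map τ γ' = Γ.psh.map (f ≫ τ) γ := by simp [← k]
  have hab' := ((El_pi_congr cp A B (Category.comp_id _) (kid γ)).2 a b).1 hab
  refine (PTy.precomp_heq (A.app γ).1 (depTy cp A B γ) f rfl a.1 rfl
    (a' := (A.app γ).1.tr (Category.assoc _ _ _) c) ((A.app γ).1.tr_heq _ _).symm).trans ?_
  refine HEq.trans ?_ (PTy.precomp_heq (El A) (El B) f k b.1 rfl
    (a' := (El A).tr e c') ((El A).tr_heq _ _).symm).symm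
  exact hab' _ _ _ _ (((A.app γ).1.tr_heq _ _).trans (hc.trans ((El A).tr_heq _ _).symm))

theorem El_sigmaCode : El (sigmaCode cp A B) = (El A).sigma (El B) := by
  have kid : ∀ {P : TimeObj Clk} (γ : Γ.psh.obj P), Γ.psh.map (𝟙 P) γ = γ := fun γ => by simp
  refine PTy.ext_heq (fun P γ => (El_sigma_congr cp A B (Category.comp_id _) (kid γ)).1) ?_
  intro P Q f γ γ' k a b hab
  refine (El_act_heq (sigmaCode cp A B) f k a).trans ?_
  obtain ⟨h₁, h₂⟩ := ((El_sigma_congr cp A B (Category.comp_id _) (kid γ)).2 a b).1 hab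
  refine ((El_sigma_congr cp A B rfl k).2 _ _).2 ⟨?_, ?_⟩
  · exact El_act A (Category.comp_id _) (kid γ) f _ k h₁
  · exact El_depTy_act cp A B (Category.comp_id _) (kid γ) f _ _ h₁
      (PTy.total_map _ f rfl _) (PTy.total_map _ f k _) h₂

section Inclusion

variable (h : Δ ⊆ Δ') {P Q : TimeObj Clk} (γ : Γ.psh.obj P)
  (σ : P.im ((Γ.clkMap Δ').app γ) ⟶ Q)

/-- Naturality of `B` along `[inl, σ + i]`, which maps the point of `Γ, x : El_Δ(A)` formed with the
restriction `σ ∘ k` of `σ` to `γ[Δ]` to the one formed with `σ`. -/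
theorem inU_depTy_restrict (x : ((inU h A).app γ).1.fam σ)
    (x' : (A.app γ).1.fam (imSub h γ ≫ σ)) (hx : HEq x x') :
    ∃ f : (cp.sumObj Q P).im _ ⟶ (cp.sumObj Q P).im _,
      SmallTy.restrict f (B.app (extPt cp A γ (imSub h γ ≫ σ) x')) =
        (inUFam h A B).app (extPt cp (inU h A) γ σ x) ∧
      f ≫ extIncl cp (inU h A) γ σ x = extIncl cp A γ (imSub h γ ≫ σ) x' := by
  have hw : P.imIncl ((Γ.clkMap Δ).app γ) ≫ cp.extendMap σ = (imSub h γ ≫ σ) ≫ cp.inl Q P := by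
    rw [Category.assoc, ← cp.imIncl_extendMap σ]; rfl
  have hpt : (Γ.ext (El A)).psh.map (cp.copair (cp.inl Q P) (cp.extendMap σ))
      (extPt cp A γ (imSub h γ ≫ σ) x') =
      ⟨(extPt cp (inU h A) γ σ x).1, (extPt cp (inU h A) γ σ x).2⟩ := by
    refine (map_extPt cp A _ x' _ (cp.extendMap σ)
      (cp.extendMap_copair _ _ _ _ hw fun _ _ => rfl) rfl _ (cp.inl_copair _ _)).trans ?_
    refine congrArg (Sigma.mk _) (eq_of_heq ?_)
    refine (slide_heq' _ _ _ _ _ _).trans (HEq.trans ?_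
      (slide_heq' _ _ _ _ (cp.imIncl_extendMap σ) _).symm)
    exact (A.app γ).1.act_heq rfl _ _ rfl hx.symm
  refine ⟨TimeObj.cores _ (((Γ.ext (El A)).clkMap Δ).nat _ _ |>.trans (congrArg _ hpt)) ≫
    imSub (Γ := Γ.ext (El A)) h ⟨(extPt cp (inU h A) γ σ x).1, (extPt cp (inU h A) γ σ x).2⟩,
    congrArg (SmallTy.restrict (imSub (Γ := Γ.ext (El A)) h _)) (B.nat _ hpt), ?_⟩
  refine cp.inl_cancel (P := P) ?_
  have h₁ := cp.leftIncl_inl (extPt_clk cp A γ (imSub h γ ≫ σ) x')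
  have h₂ := cp.leftIncl_inl (extPt_clk cp (inU h A) γ σ x)
  refine (congrArg (fun m => (TimeObj.cores _ _ ≫ imSub h _) ≫ m) h₂).trans ?_
  -- Composing with the inclusion of the image gives `extIncl ≫ inl ≫ [inl, σ + i]`.
  refine (congrArg (· ≫ cp.copair (cp.inl Q P) (cp.extendMap σ)) h₁).symm.trans ?_
  rw [Category.assoc, cp.inl_copair]
  rfl

theorem inU_depTy_fam (x : ((inU h A).app γ).1.fam σ)
    (x' : (A.app γ).1.fam (imSub h γ ≫ σ)) (hx : HEq x x') :
    (depTy cp (inU h A) (inUFam h A B) γ).fam (P := Q) ⟨σ, x⟩ =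
      (depTy cp A B γ).fam (P := Q) ⟨imSub h γ ≫ σ, x'⟩ := by
  obtain ⟨f, hf, hf'⟩ := inU_depTy_restrict cp A B h γ σ x x' hx
  exact SmallTy.restrict_fam hf hf'

theorem inU_depTy_act {R : TimeObj Clk} (τ : Q ⟶ R) (x : ((inU h A).app γ).1.fam σ)
    (x' : (A.app γ).1.fam (imSub h γ ≫ σ)) (hx : HEq x x')
    {p : ((inU h A).app γ).1.total.obj R} {q : (A.app γ).1.total.obj R}
    (hp : ((inU h A).app γ).1.total.map τ ⟨σ, x⟩ = p)
    (hq : (A.app γ).1.total.map τ ⟨imSub h γ ≫ σ, x'⟩ = q)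
    {y : (depTy cp (inU h A) (inUFam h A B) γ).fam (P := Q) ⟨σ, x⟩}
    {y' : (depTy cp A B γ).fam (P := Q) ⟨imSub h γ ≫ σ, x'⟩} (hy : HEq y y') :
    HEq ((depTy cp (inU h A) (inUFam h A B) γ).act τ hp y) ((depTy cp A B γ).act τ hq y') := by
  obtain ⟨f, hf, hf'⟩ := inU_depTy_restrict cp A B h γ σ x x' hx
  exact (depTy_act_heq cp (inU h A) (inUFam h A B) γ τ hp y).trans
    ((SmallTy.restrict_act hf hf' τ hy).trans (depTy_act_heq cp A B γ τ hq y').symm)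

end Inclusion

theorem piCode_inU [Infinite Clk] (h : Δ ⊆ Δ') :
    piCode cp (inU h A) (inUFam h A B) = inU h (piCode cp A B) :=
  Tm.ext_app fun γ => Subtype.ext <| PTy.pi_subst (s := yoMap (imSub h γ)) rfl
    (fun _ σ x x' hx => inU_depTy_fam cp A B h γ σ x x' hx)
    (fun _ _ τ σ _ _ x x' hx _ _ hy => inU_depTy_act cp A B h γ σ τ x x' hx _ _ hy)

theorem sigmaCode_inU (h : Δ ⊆ Δ') :
    sigmaCode cp (inU h A) (inUFam h A B) = inU h (sigmaCode cp A B) :=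
  Tm.ext_app fun γ => Subtype.ext <| PTy.sigma_subst (s := yoMap (imSub h γ)) rfl
    (fun _ σ x x' hx => inU_depTy_fam cp A B h γ σ x x' hx)
    (fun _ _ τ σ _ _ x x' hx _ _ hy => inU_depTy_act cp A B h γ σ τ x x' hx _ _ hy)

end Comparison

end ClockModel

theorem mainTheorem3 {Clk : Type} [DecidableEq Clk] [Infinite Clk] (cp : ClockSum Clk)
    {K : Type} (Γ : Ctx.{w} Clk K) (Δ : Finset K)
    (A : Tm.{u + 1} Γ.psh (Γ.U Δ))
    (B : Tm.{u + 1} (Γ.ext (El A)).psh ((Γ.ext (El A)).U Δ)) :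
    El (piCode cp A B) = (El A).pi (El B) ∧
    El (sigmaCode cp A B) = (El A).sigma (El B) ∧
    ∀ (Δ' : Finset K) (h : Δ ⊆ Δ'),
      piCode cp (inU h A) (inUFam h A B) = inU h (piCode cp A B) ∧
      sigmaCode cp (inU h A) (inUFam h A B) = inU h (sigmaCode cp A B) :=
  ⟨El_piCode cp A B, El_sigmaCode cp A B, fun _ h =>
    ⟨piCode_inU cp A B h, sigmaCode_inU cp A B h⟩⟩
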